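/- **Setting.** Let $\Omega\subset\mathbb R^n$ be a domain, $\Omega_0\subset\Omega$ a bounded subdomain, and $\Gamma_D\subset\partial\Omega\cap\partial\Omega_0$. Let $$L(u,v)=\int_{\Omega_0}\big(A\nabla u\cdot\nabla v+(b\cdot\nabla u)\,v+c\,uv\big)\,dx ,$$ where the entries of $A$ (a positive definite, not necessarily symmetric, $n\times n$ matrix), $b$ and $c$ are measurable on $\Omega_0$ and bounded there by $\Lambda$. Put $H^1_{D,0}(\Omega_0)=\{u\in H^1(\Omega_0): u|_{\Gamma_D}=0\}$ and, for $B\subset\Omega_0$, let $H^1_<(B)$ be the set of functions that, extended by zero outside $B$, belong to $H^1(\Omega)$. For sets $X,Y$, $\mathrm{dist}(X,Y)=\inf_{x\in X,\,y\in Y}|x-y|$ ($=\infty$ if $X$ or $Y$ is empty). Let $\mathcal T$ be a triangulation: a finite family of pairwise disjoint, bounded, connected open elements $T\subset\Omega$ with boundaries of measure zero (e.g. open simplices), each meeting $\Omega_0$, with $\Omega_0\subset\bigcup_{T\in\mathcal T}\overline T$; put $h_T=\mathrm{diam}(T)$. Let $S_D$ be a linear space of functions (the trial space) and $S_{D,0}=S_D\cap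 H^1_{D,0}(\Omega_0)$. **Assumptions.** * R1 (local coercivity). There are $d_0>0$ and $C_1>0$ such that, whenever $B$ is the intersection of $\Omega_0$ with an open ball of diameter at most $d_0$, $$C_1^{-1}\|u\|_{H^1(B)}^2\le L(u,u)\le C_1\|u\|_{H^1(B)}^2\qquad\text{for all } u\in H^1_<(B).$$ * A2 (inverse properties). For some integer $r_2\ge1$ and some constant $C_2$, for all $\chi\in S_D$, $T\in\mathcal T$, $1\le p\le q\le\infty$ and integers $0\le\nu\le s\le r_2$, $$\|\chi\|_{W^s_q(T)}\le C_2\,h_T^{\nu-s+\frac np-\frac nq}\,\|\chi\|_{W^\nu_p(T)} .$$ Let $G_0\subset G\subset\Omega_0$ with $\mathrm{dist}(G_0,\partial G\setminus\partial\Omega)=d$, where $0<d\le 2d_0$, and assume further, for some integer $r_3\ge0$ and some function $K\mapsto C_3(K)$, that for all open sets $G_1\subset G_2\subset G$ with $\mathrm{dist}(G_1,\partial G_2\setminus\partial\Omega)=\frac d4$ there is a map $I$ with the following two properties. * A1 (local interpolant). $Iu\in S_D\cap H^1_<(G_2)$ for each $u\in H^1_<(G_1)$, and $Iu\in S_{D,0}$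 for each $u\in H^1_{D,0}(\Omega_0)$. * A3 (superapproximation). For each $K>0$, each $\omega\in C^\infty(\Omega_0)\cap H^1_<(G_1)$ with $|D^j\omega|\le K d^{-j}$ on $\Omega_0$ for all integers $0\le j\le r_3$, each $\chi\in S_{D,0}$, and each $T\in\mathcal T$ with $h_T\le d$, $$\|\omega^2\chi-I(\omega^2\chi)\|_{H^1(T)}\le C_3(K)\Big(\frac{h_T}{d}\|\nabla(\omega\chi)\|_{L_2(T)}+\frac{h_T}{d^2}\|\chi\|_{L_2(T)}\Big).$$ **Claim (discrete Caccioppoli estimate).** Suppose in addition that $h_T/d\le\frac14$ for every $T\in\mathcal T$ with $T\cap G\ne\emptyset$, and that $u_h\in S_{D,0}$ is discrete harmonic, i.e. $$L(u_h,v_h)=0\qquad\text{for all } v_h\in S_{D,0}\cap H^1_<(\Omega_0).$$ Then $$\|u_h\|_{H^1(G_0)}\le \frac Cd\,\|u_h\|_{L_2(G)},$$ where $C>0$ depends only on $n,r_2,r_3$, on $\Lambda$ and $C_1$ (that is, on $L$), and on the constants $C_2$ and $C_3(\cdot)$ of A2 and A3. In particular it does not depend on $d$, $G_0$, $G$, the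 mesh, $S_D$ or $u_h$. -/

import Mathlib

open MeasureTheory Set Filter Topology
open scoped ENNReal ContDiff

noncomputable section

namespace LocalFEM

/-- Euclidean space of dimension `n`. -/
abbrev E (n : ℕ) := EuclideanSpace ℝ (Fin n)

/-- Multi-indices of length `n`. -/
abbrev MultiIndex (n : ℕ) := Fin n → ℕ

/-- The order of a multi-index. -/
def order {n : ℕ} (α : MultiIndex n) : ℕ := ∑ i, α i

/-- The finite set of all multi-indices of order at most `k`. -/
def multiIndicesLE (n k : ℕ) : Finset (MultiIndex n) :=
  (Finset.Iic (fun _ : Fin n => k)).filter (fun α => order α ≤ k)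

/-- The classical partial derivative in direction `e_i`. -/
def partialDeriv {n : ℕ} (i : Fin n) (f : E n → ℝ) : E n → ℝ :=
  fun x => fderiv ℝ f x (EuclideanSpace.single i (1 : ℝ))

/-- The classical derivative `D^α f` (used for smooth `f` only). -/
def multiDeriv {n : ℕ} (α : MultiIndex n) (f : E n → ℝ) : E n → ℝ :=
  (List.finRange n).foldr (fun i g => (partialDeriv i)^[α i] g) f

/-! ### Sobolev norms -/

/-- On the open set `U`, the function `g` is a weak derivative `D^α u`. -/
structure IsWeakDeriv {n : ℕ} (U : Set (E n)) (α : MultiIndex n) (u g : E n → ℝ) : Prop where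
  locallyIntegrable : LocallyIntegrableOn u U
  locallyIntegrable_deriv : LocallyIntegrableOn g U
  integral_eq : ∀ φ : E n → ℝ, ContDiff ℝ ∞ φ → HasCompactSupport φ → tsupport φ ⊆ U →
    ∫ x in U, u x * multiDeriv α φ x = (-1) ^ order α * ∫ x in U, g x * φ x

/-- `u` possesses a weak derivative `D^α u` on `U`. -/
def HasWeakDeriv {n : ℕ} (U : Set (E n)) (α : MultiIndex n) (u : E n → ℝ) : Prop :=
  ∃ g, IsWeakDeriv U α u g

open Classical in
/-- The weak derivative `D^α u` on the open set `U` (almost everywhere unique if it exists). -/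
def weakDeriv {n : ℕ} (U : Set (E n)) (α : MultiIndex n) (u : E n → ℝ) : E n → ℝ :=
  if h : HasWeakDeriv U α u then h.choose else 0

/-- The first weak partial derivative `∂_i u` on `U`. -/
def weakPartial {n : ℕ} (U : Set (E n)) (i : Fin n) (u : E n → ℝ) : E n → ℝ :=
  weakDeriv U (Pi.single i 1) u

/-- The `ℓ^p` combination of the `L_p(D)` norms of `D^α u`, `α ∈ s`, the weak derivatives being
taken on the open set `U ⊇ D`: `(∑ ‖D^α u‖_{L_p(D)}^p)^{1/p}`, and the maximum for `p = ∞`.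
It is `∞` if one of the derivatives does not exist. -/
def derivNorm {n : ℕ} (U D : Set (E n)) (s : Finset (MultiIndex n)) (p : ℝ≥0∞)
    (u : E n → ℝ) : ℝ≥0∞ :=
  open Classical in
  if ∀ α ∈ s, HasWeakDeriv U α u then
    if p = ⊤ then s.sup (fun α => eLpNorm (weakDeriv U α u) ⊤ (volume.restrict D))
    else (∑ α ∈ s, eLpNorm (weakDeriv U α u) p (volume.restrict D) ^ p.toReal) ^ (1 / p.toReal)
  else ⊤

/-- The norm of `W_p^k(U)` for an open set `U`; it is finite exactly on `W_p^k(U)`. -/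
def sobolevNorm {n : ℕ} (U : Set (E n)) (k : ℕ) (p : ℝ≥0∞) (u : E n → ℝ) : ℝ≥0∞ :=
  derivNorm U U (multiIndicesLE n k) p u

/-- The norm of `H¹(D)` of a function in `H¹(U)`, where `D` is a subset of the open set `U`:
`(∫_D u² + |∇u|²)^{1/2}`. For open `D` this is the usual norm of `H¹(D)`. -/
def h1NormOn {n : ℕ} (U D : Set (E n)) (u : E n → ℝ) : ℝ≥0∞ :=
  derivNorm U D (multiIndicesLE n 1) 2 u

/-- `‖∇u‖_{L_2(U)}`. -/
def gradNorm {n : ℕ} (U : Set (E n)) (u : E n → ℝ) : ℝ≥0∞ :=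
  derivNorm U U (Finset.univ.image (fun i : Fin n => (Pi.single i 1 : MultiIndex n))) 2 u

/-- `‖u‖_{L_2(D)}`. -/
def l2Norm {n : ℕ} (D : Set (E n)) (u : E n → ℝ) : ℝ≥0∞ :=
  eLpNorm u 2 (volume.restrict D)

/-- The space `H¹(U)`. -/
def H1 {n : ℕ} (U : Set (E n)) : Set (E n → ℝ) := {u | sobolevNorm U 1 2 u < ⊤}

/-- `u|_Γ = 0` in the sense of traces from `U`: at almost every point of `Γ`, with respect to
the `(n-1)`-dimensional surface measure, the means of `|u|` over `B(x,ρ) ∩ U` tend to zero. -/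
def TraceZero {n : ℕ} (U Γ : Set (E n)) (u : E n → ℝ) : Prop :=
  ∀ᵐ x ∂(μH[(n : ℝ) - 1] : Measure (E n)), x ∈ Γ →
    Tendsto (fun ρ : ℝ => ⨍ y in Metric.ball x ρ ∩ U, |u y|) (𝓝[>] 0) (𝓝 0)

/-- `H¹_{D,0}(Ω₀)`: the functions in `H¹(Ω₀)` that vanish on `Γ_D`. -/
def H1D0 {n : ℕ} (Ω₀ ΓD : Set (E n)) : Set (E n → ℝ) := {u | u ∈ H1 Ω₀ ∧ TraceZero Ω₀ ΓD u}

/-- `H¹_<(B)` for `B ⊆ Ω₀ ⊆ Ω`: the `H¹` functions that vanish on `Ω \ B`. They are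
zero on `∂B \ ∂Ω` because they belong to `H¹` across that part of `∂B`. -/
def H1Lt {n : ℕ} (Ω B : Set (E n)) : Set (E n → ℝ) :=
  {u | u ∈ H1 Ω ∧ ∀ᵐ x, x ∈ Ω \ B → u x = 0}

/-! ### The differential operator -/

/-- The coefficients of `-div(A ∇u) + b · ∇u + c u`. -/
structure Coeffs (n : ℕ) where
  A : E n → Matrix (Fin n) (Fin n) ℝ
  b : E n → E n
  c : E n → ℝ

/-- The coefficients are measurable and bounded by `Λ` on `Ω₀`, and `A` is positive definite
(not necessarily symmetric). -/
structure Coeffs.Admissible {n : ℕ} (P : Coeffs n) (Ω₀ : Set (E n)) (Λ : ℝ) : Prop where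
  measurable_A : ∀ i j, AEMeasurable (fun x => P.A x i j) (volume.restrict Ω₀)
  measurable_b : ∀ i, AEMeasurable (fun x => P.b x i) (volume.restrict Ω₀)
  measurable_c : AEMeasurable P.c (volume.restrict Ω₀)
  bound_A : ∀ᵐ x ∂(volume.restrict Ω₀), ∀ i j, |P.A x i j| ≤ Λ
  bound_b : ∀ᵐ x ∂(volume.restrict Ω₀), ‖P.b x‖ ≤ Λ
  bound_c : ∀ᵐ x ∂(volume.restrict Ω₀), |P.c x| ≤ Λ
  posDef_A : ∀ᵐ x ∂(volume.restrict Ω₀), ∀ ξ : Fin n → ℝ, ξ ≠ 0 →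
    0 < ∑ i, ∑ j, P.A x i j * ξ j * ξ i

/-- The bilinear form `L(u,v) = ∫ (A ∇u · ∇v + (b · ∇u) v + c u v) dx`, over `Ω₀`. -/
def Coeffs.form {n : ℕ} (P : Coeffs n) (Ω₀ : Set (E n)) (u v : E n → ℝ) : ℝ :=
  ∫ x in Ω₀, ((∑ i, ∑ j, P.A x i j * weakPartial Ω₀ j u x * weakPartial Ω₀ i v x)
    + (∑ i, P.b x i * weakPartial Ω₀ i u x) * v x + P.c x * u x * v x)

/-- Local coercivity: `C₁⁻¹ ‖u‖²_{H¹(B)} ≤ L(u,u) ≤ C₁ ‖u‖²_{H¹(B)}` for `u ∈ H¹_<(B)`, whenever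
`B` is the intersection of `Ω₀` with an open ball of diameter at most `d₀`. -/
structure LocallyCoercive {n : ℕ} (P : Coeffs n) (Ω Ω₀ : Set (E n)) (d₀ C₁ : ℝ) : Prop where
  d₀_pos : 0 < d₀
  C₁_pos : 0 < C₁
  coercive : ∀ (z : E n) (ρ : ℝ), 0 < ρ → 2 * ρ ≤ d₀ →
    ∀ u ∈ H1Lt Ω (Metric.ball z ρ ∩ Ω₀),
      C₁⁻¹ * (sobolevNorm (Metric.ball z ρ ∩ Ω₀) 1 2 u).toReal ^ 2 ≤ P.form Ω₀ u u ∧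
      P.form Ω₀ u u ≤ C₁ * (sobolevNorm (Metric.ball z ρ ∩ Ω₀) 1 2 u).toReal ^ 2

/-! ### Meshes and finite element spaces -/

/-- `dist(X, Y) = inf {|x - y|}`, which is `∞` if one of the sets is empty. -/
def setDist {n : ℕ} (X Y : Set (E n)) : ℝ≥0∞ := ⨅ x ∈ X, Metric.infEDist x Y

/-- A triangulation covering `Ω₀`: finitely many disjoint (open) elements in `Ω` that meet `Ω₀`.
The elements may be simplices, but curved elements are admitted as well. -/
structure IsTriangulation {n : ℕ} (Ω Ω₀ : Set (E n)) (𝒯 : Set (Set (E n))) : Prop where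
  finite : 𝒯.Finite
  isOpen : ∀ T ∈ 𝒯, IsOpen T
  isConnected : ∀ T ∈ 𝒯, IsConnected T
  isBounded : ∀ T ∈ 𝒯, Bornology.IsBounded T
  null_frontier : ∀ T ∈ 𝒯, volume (frontier T) = 0
  pairwiseDisjoint : 𝒯.PairwiseDisjoint id
  subset : ∀ T ∈ 𝒯, T ⊆ Ω
  inter_nonempty : ∀ T ∈ 𝒯, (T ∩ Ω₀).Nonempty
  covers : Ω₀ ⊆ ⋃ T ∈ 𝒯, closure T

/-- The element diameter `h_T`. -/
def meshSize {n : ℕ} (T : Set (E n)) : ℝ := Metric.diam T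

/-- `I` is a local interpolant for the pair `G₁ ⊆ G`: it maps `H¹_<(G₁)` to `S_D ∩ H¹_<(G)`, and
`H¹_{D,0}(Ω₀)` to `S_{D,0} = S_D ∩ H¹_{D,0}(Ω₀)`. -/
def IsLocalInterpolant {n : ℕ} (Ω Ω₀ ΓD : Set (E n)) (S : Submodule ℝ (E n → ℝ))
    (G₁ G : Set (E n)) (I : (E n → ℝ) → (E n → ℝ)) : Prop :=
  (∀ u ∈ H1Lt Ω G₁, I u ∈ S ∧ I u ∈ H1Lt Ω G) ∧
  (∀ u ∈ H1D0 Ω₀ ΓD, I u ∈ S ∧ I u ∈ H1D0 Ω₀ ΓD)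

/-- Inverse inequalities of order up to `r`, with constant `C`:
`‖χ‖_{W_q^s(T)} ≤ C h_T^{ν - s + n/p - n/q} ‖χ‖_{W_p^ν(T)}` (with `n/∞ = 0`). -/
def InverseProperties {n : ℕ} (𝒯 : Set (Set (E n))) (S : Submodule ℝ (E n → ℝ))
    (r : ℕ) (C : ℝ) : Prop :=
  ∀ χ ∈ S, ∀ T ∈ 𝒯, ∀ p q : ℝ≥0∞, 1 ≤ p → p ≤ q → ∀ ν s : ℕ, ν ≤ s → s ≤ r →
    sobolevNorm T s q χ ≤
      ENNReal.ofReal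
        (C * meshSize T ^ ((ν : ℝ) - (s : ℝ) + (n : ℝ) / p.toReal - (n : ℝ) / q.toReal)) *
      sobolevNorm T ν p χ

/-- Superapproximation at scale `d` for the interpolant `I`: for all cutoff functions
`η ∈ C^∞(Ω₀) ∩ H¹_<(G₁)` with `|D^j η| ≤ K d^{-j}` on `Ω₀` for `0 ≤ j ≤ r`, all `χ ∈ S_{D,0}`, and all
elements with `h_T ≤ d`. The constant `C K` depends on the constant `K` in the bounds for `η`. -/
def Superapproximation {n : ℕ} (Ω Ω₀ ΓD : Set (E n)) (𝒯 : Set (Set (E n)))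
    (S : Submodule ℝ (E n → ℝ)) (G₁ : Set (E n)) (I : (E n → ℝ) → (E n → ℝ))
    (d : ℝ) (r : ℕ) (C : ℝ → ℝ) : Prop :=
  ∀ K : ℝ, 0 < K → ∀ η : E n → ℝ, ContDiffOn ℝ ∞ η Ω₀ → η ∈ H1Lt Ω G₁ →
    (∀ j : ℕ, j ≤ r → ∀ x ∈ Ω₀, ‖iteratedFDeriv ℝ j η x‖ ≤ K / d ^ j) →
    ∀ χ ∈ S, χ ∈ H1D0 Ω₀ ΓD → ∀ T ∈ 𝒯, meshSize T ≤ d →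
      sobolevNorm T 1 2 (fun x => η x ^ 2 * χ x - I (fun y => η y ^ 2 * χ y) x) ≤
        ENNReal.ofReal (C K) *
          (ENNReal.ofReal (meshSize T / d) * gradNorm T (fun x => η x * χ x) +
            ENNReal.ofReal (meshSize T / d ^ 2) * l2Norm T χ)

/-- For every pair of open subsets `G₁ ⊆ G₂` of `G` with `dist(G₁, ∂G₂ \ ∂Ω) = δ` there is a
local interpolant which has the superapproximation property at scale `d`. -/
def LocalApproximation {n : ℕ} (Ω Ω₀ ΓD : Set (E n)) (𝒯 : Set (Set (E n)))
    (S : Submodule ℝ (E n → ℝ)) (G : Set (E n)) (δ d : ℝ) (r : ℕ) (C : ℝ → ℝ) : Prop :=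
  ∀ G₁ G₂ : Set (E n), IsOpen G₁ → IsOpen G₂ → G₁ ⊆ G₂ → G₂ ⊆ G →
    setDist G₁ (frontier G₂ \ frontier Ω) = ENNReal.ofReal δ →
    ∃ I : (E n → ℝ) → (E n → ℝ), IsLocalInterpolant Ω Ω₀ ΓD S G₁ G₂ I ∧
      Superapproximation Ω Ω₀ ΓD 𝒯 S G₁ I d r C

end LocalFEM

end

open LocalFEM

namespace LocalFEM

variable {n : ℕ}

/-! ### Multi-indices of order at most one -/

/-! Caccioppoli's argument is run on a ball of radius `d` around a point `z` of `G₀`, and the balls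
are then summed. Take a cutoff `ζ` equal to one on the part of `G` within `d/8` of `z` and supported
within `d/4`; put `w = ζu`, let `v = I(ζ²u)` and `e = ζ²u - v`. Since `v` is an admissible test
function, `L(u, v) = 0`, hence `L(w, w) = [L(w, w) - L(u, ζ²u)] + L(u, e)`. Local coercivity bounds
the left side below by a multiple of `‖w‖²` in `H¹`. The bracket is a commutator: each of its terms
contains a derivative of `ζ`, of size `1/d`, and `u` undifferentiated, so Young's inequality gives a
small multiple of `‖w‖²` plus a multiple of `d⁻²‖u‖²` in `L₂` (`Coeffs.abs_density_sub_le`).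

The last term is the discrete one. On an element of diameter `h`, the inverse inequality costs `1/h`
in the `H¹` norm of `u`, while superapproximation gains `h/d` in the norm of `e`. Young's inequality
with weight `M h²/d²` cancels every power of `h` and leaves `d⁻²‖u‖²` plus a multiple of `‖w‖²` of
order `1/M` (`Coeffs.integral_abs_density_element_le`). For large `M` everything in `w` is absorbed,
which is `exists_energy_ball_le`. Centres chosen from a grid of cubes give bounded overlap
(`exists_lintegral_covering`), and the sum is the theorem.

The geometric point is that `G` need not be open and may touch `∂Ω`. Near `z` the frontier of `G`
lies in `∂Ω`, so inside `Ω` the set `G` is locally all or nothing. Hence the cutoff may simply be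
set to zero off `G` (`exists_cutoff_inter`), and small elements cannot leave `G`. The interpolation
hypothesis demands a distance of exactly `d/4`; connectedness of `Ω` supplies a pair of sets
realizing it (`setDist_eq_of_isPreconnected`). -/

lemma order_zero : order (0 : MultiIndex n) = 0 := by simp [order]

lemma order_single (i : Fin n) : order (Pi.single i 1 : MultiIndex n) = 1 := by
  simp [order]

lemma multiDeriv_zero (f : E n → ℝ) : multiDeriv 0 f = f := by
  unfold multiDeriv
  induction List.finRange n with
  | nil => rfl
  | cons a l _ => simp

lemma foldr_partialDeriv_single (i : Fin n) (f : E n → ℝ) (l : List (Fin n)) (hl : l.Nodup) :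
    l.foldr (fun j g => (partialDeriv j)^[(Pi.single i 1 : MultiIndex n) j] g) f =
      if i ∈ l then partialDeriv i f else f := by
  induction l with
  | nil => simp
  | cons a l ih =>
    obtain ⟨ha, hl⟩ := List.nodup_cons.1 hl
    rw [List.foldr_cons, ih hl]
    by_cases h : a = i
    · subst h
      simp [ha]
    · simp [Ne.symm h, h]

lemma multiDeriv_single (i : Fin n) (f : E n → ℝ) :
    multiDeriv (Pi.single i 1) f = partialDeriv i f := by
  unfold multiDeriv
  rw [foldr_partialDeriv_single i f _ (List.nodup_finRange n), if_pos (List.mem_finRange i)]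

lemma multiIndicesLE_zero : multiIndicesLE n 0 = {0} := by
  ext α
  simp only [multiIndicesLE, Finset.mem_filter, Finset.mem_Iic, Finset.mem_singleton]
  constructor
  · rintro ⟨h, -⟩
    exact le_antisymm h (zero_le)
  · rintro rfl
    exact ⟨le_rfl, by simp [order]⟩

lemma multiIndicesLE_one : multiIndicesLE n 1 =
    insert 0 (Finset.univ.image fun i : Fin n => (Pi.single i 1 : MultiIndex n)) := by
  ext α
  simp only [multiIndicesLE, Finset.mem_filter, Finset.mem_Iic, Finset.mem_insert,
    Finset.mem_image, Finset.mem_univ, true_and]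
  constructor
  · rintro ⟨-, h⟩
    by_cases h0 : α = 0
    · exact Or.inl h0
    · right
      obtain ⟨i, hi⟩ := Function.ne_iff.1 h0
      refine ⟨i, ?_⟩
      have hi' : 1 ≤ α i := Nat.one_le_iff_ne_zero.2 hi
      have hsum : order α = α i + ∑ j ∈ Finset.univ.erase i, α j :=
        (Finset.add_sum_erase _ _ (Finset.mem_univ i)).symm
      have hrest : ∑ j ∈ Finset.univ.erase i, α j = 0 := by omega
      ext j
      by_cases hj : j = i
      · subst hj
        rw [Pi.single_eq_same]
        omega
      · rw [Pi.single_eq_of_ne hj]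
        exact ((Finset.sum_eq_zero_iff.1 hrest) j (by simp [hj])).symm
  · rintro (rfl | ⟨i, rfl⟩)
    · exact ⟨fun _ => by simp, by simp [order_zero]⟩
    · refine ⟨fun j => ?_, (order_single i).le⟩
      by_cases hj : j = i
      · subst hj; simp
      · simp [Pi.single_eq_of_ne hj]

lemma single_injective :
    Function.Injective fun i : Fin n => (Pi.single i 1 : MultiIndex n) := by
  intro i j h
  by_contra hij
  have := congrFun h i
  simp [Pi.single_eq_of_ne hij] at this

lemma zero_notMem_image_single :
    (0 : MultiIndex n) ∉ Finset.univ.image fun i : Fin n => (Pi.single i 1 : MultiIndex n) := by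
  simp only [Finset.mem_image, Finset.mem_univ, true_and, not_exists]
  intro i h
  have := congrFun h i
  simp at this

/-! ### Weak derivatives -/

/-- A test function on `V` is one on `U`, and the integrands vanish off its support, so both domains
give the same integrals. -/
lemma IsWeakDeriv.mono {U V : Set (E n)} {α : MultiIndex n} {u g : E n → ℝ}
    (h : IsWeakDeriv U α u g) (hVU : V ⊆ U) : IsWeakDeriv V α u g := by
  refine ⟨h.1.mono_set hVU, h.2.mono_set hVU, fun φ hφ hc hs => ?_⟩
  have key := h.3 φ hφ hc (hs.trans hVU)
  have h1 : ∀ f : E n → ℝ, (∀ x, x ∉ tsupport φ → f x = 0) → ∫ x in V, f x = ∫ x in U, f x := by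
    intro f hf
    have : ∀ W : Set (E n), tsupport φ ⊆ W → ∫ x in W, f x = ∫ x, f x := fun W hW =>
      setIntegral_eq_integral_of_forall_compl_eq_zero fun x hx => hf x fun hx' => hx (hW hx')
    rw [this V hs, this U (hs.trans hVU)]
  -- Differentiation does not enlarge supports; the induction runs over coordinates and then over
  -- the number of derivatives in each.
  have hsupp : tsupport (multiDeriv α φ) ⊆ tsupport φ := by
    have hp : ∀ (i : Fin n) (f : E n → ℝ), tsupport f ⊆ tsupport φ →
        tsupport (partialDeriv i f) ⊆ tsupport φ := fun i f hf =>
      (closure_mono fun x hx => by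
        by_contra hx'
        exact hx (by simp [partialDeriv, fderiv_of_notMem_tsupport (𝕜 := ℝ) hx'])).trans
        ((isClosed_tsupport f).closure_subset.trans hf)
    unfold multiDeriv
    induction List.finRange n with
    | nil => exact subset_rfl
    | cons a l ih =>
      rw [List.foldr_cons]
      generalize α a = m
      generalize List.foldr (fun i g => (partialDeriv i)^[α i] g) φ l = f at ih ⊢
      induction m with
      | zero => exact ih
      | succ m ihm => rw [Function.iterate_succ_apply']; exact hp _ _ ihm
  rw [h1 _ fun x hx => ?_, h1 _ fun x hx => ?_, key]
  · rw [image_eq_zero_of_notMem_tsupport hx, mul_zero]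
  · rw [image_eq_zero_of_notMem_tsupport fun hx' => hx (hsupp hx'), mul_zero]

/-- Fundamental lemma of the calculus of variations applied to `g - g'`. It serves to replace the
chosen `weakDeriv` by explicit formulas, and to see that gradients vanish on open sets where the
function does. -/
lemma IsWeakDeriv.ae_unique {U : Set (E n)} {α : MultiIndex n} {u u' g g' : E n → ℝ}
    (hU : IsOpen U) (h : IsWeakDeriv U α u g) (h' : IsWeakDeriv U α u' g')
    (huu : u =ᵐ[volume.restrict U] u') : g =ᵐ[volume.restrict U] g' := by
  have key := hU.ae_eq_zero_of_integral_contDiff_smul_eq_zero (μ := volume) (f := g - g')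
    (h.2.sub h'.2) fun φ hφ hc hs => ?_
  · rw [EventuallyEq, ae_restrict_iff' hU.measurableSet]
    filter_upwards [key] with x hx hxU
    have := hx hxU
    simp only [Pi.sub_apply] at this
    linarith
  · have int : ∀ f : E n → ℝ, LocallyIntegrableOn f U →
        Integrable (fun x => f x * φ x) := fun f hf => by
      have h1 : IntegrableOn (fun x => f x * φ x) (tsupport φ) :=
        (hf.integrableOn_compact_subset hs hc).mul_continuousOn hφ.continuous.continuousOn hc
      refine (integrableOn_iff_integrable_of_support_subset fun x hx => ?_).1 h1
      by_contra hx'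
      exact hx (by simp [image_eq_zero_of_notMem_tsupport hx'])
    have e1 : ∀ f : E n → ℝ, ∫ x in U, f x * φ x = ∫ x, f x * φ x := fun f =>
      setIntegral_eq_integral_of_forall_compl_eq_zero fun x hx => by
        rw [image_eq_zero_of_notMem_tsupport fun hx' => hx (hs hx'), mul_zero]
    have e2 : ∫ x in U, u x * multiDeriv α φ x = ∫ x in U, u' x * multiDeriv α φ x :=
      integral_congr_ae (by filter_upwards [huu] with x hx; rw [hx])
    have e3 := h.3 φ hφ hc hs
    rw [e2, h'.3 φ hφ hc hs, e1, e1] at e3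
    have e4 : ∫ x, g x * φ x = ∫ x, g' x * φ x := by
      have : ((-1 : ℝ)) ^ order α ≠ 0 := pow_ne_zero _ (by norm_num)
      exact (mul_left_cancel₀ this e3).symm
    have e5 : (fun x => φ x • (g - g') x) = fun x => g x * φ x - g' x * φ x := by
      ext x; simp; ring
    rw [e5, integral_sub (int g h.2) (int g' h'.2), e4, sub_self]

lemma isWeakDeriv_zero {U : Set (E n)} {u : E n → ℝ} (hu : LocallyIntegrableOn u U) :
    IsWeakDeriv U 0 u u :=
  ⟨hu, hu, fun φ _ _ _ => by rw [multiDeriv_zero, order_zero]; simp⟩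

lemma isWeakDeriv_weakDeriv {U : Set (E n)} {α : MultiIndex n} {u : E n → ℝ}
    (h : HasWeakDeriv U α u) : IsWeakDeriv U α u (weakDeriv U α u) := by
  unfold weakDeriv
  rw [dif_pos h]
  exact h.choose_spec

lemma IsWeakDeriv.weakDeriv_ae_eq {U : Set (E n)} {α : MultiIndex n} {u g : E n → ℝ}
    (hU : IsOpen U) (h : IsWeakDeriv U α u g) : weakDeriv U α u =ᵐ[volume.restrict U] g :=
  IsWeakDeriv.ae_unique hU (isWeakDeriv_weakDeriv ⟨g, h⟩) h (ae_eq_refl _)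

/-! ### `H¹` functions with a given gradient -/

/-- `u` belongs to `H¹(U)` and `g` is its weak gradient. -/
structure HasH1Gradient (U : Set (E n)) (u : E n → ℝ) (g : Fin n → E n → ℝ) : Prop where
  memLp : MemLp u 2 (volume.restrict U)
  memLp_deriv : ∀ i, MemLp (g i) 2 (volume.restrict U)
  weak : ∀ i, IsWeakDeriv U (Pi.single i 1) u (g i)

/-- The energy density `u² + |g|²`. -/
def energy (u : E n → ℝ) (g : Fin n → E n → ℝ) (x : E n) : ℝ := u x ^ 2 + ∑ i, g i x ^ 2

lemma energy_nonneg (u : E n → ℝ) (g : Fin n → E n → ℝ) (x : E n) : 0 ≤ energy u g x :=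
  add_nonneg (sq_nonneg _) (Finset.sum_nonneg fun _ _ => sq_nonneg _)

lemma locallyIntegrableOn_of_memLp_two {U : Set (E n)} {u : E n → ℝ}
    (h : MemLp u 2 (volume.restrict U)) : LocallyIntegrableOn u U :=
  locallyIntegrableOn_of_locallyIntegrable_restrict (h.locallyIntegrable one_le_two)

lemma eLpNorm_two_sq {μ : Measure (E n)} (f : E n → ℝ) :
    eLpNorm f 2 μ ^ (2 : ℝ) = ∫⁻ x, ENNReal.ofReal (f x ^ 2) ∂μ := by
  have := eLpNorm_nnreal_pow_eq_lintegral (f := f) (μ := μ) (p := 2) (by norm_num)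
  rw [show ((2 : NNReal) : ℝ≥0∞) = 2 from rfl, show ((2 : NNReal) : ℝ) = 2 from rfl] at this
  rw [this]
  refine lintegral_congr fun x => ?_
  rw [Real.enorm_eq_ofReal_abs, ENNReal.ofReal_rpow_of_nonneg (abs_nonneg _) (by norm_num)]
  simp

lemma eLpNorm_two_eq_sqrt {μ : Measure (E n)} {f : E n → ℝ} (hf : MemLp f 2 μ) :
    eLpNorm f 2 μ = ENNReal.ofReal (√(∫ x, f x ^ 2 ∂μ)) := by
  have h := eLpNorm_two_sq (μ := μ) f
  rw [← ofReal_integral_eq_lintegral_ofReal hf.integrable_sq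
    (ae_of_all _ fun _ => sq_nonneg _)] at h
  have h2 := congrArg (fun a : ℝ≥0∞ => a ^ ((2 : ℝ)⁻¹)) h
  simp only [← ENNReal.rpow_mul] at h2
  rw [mul_inv_cancel₀ two_ne_zero, ENNReal.rpow_one,
    ENNReal.ofReal_rpow_of_nonneg (integral_nonneg fun _ => sq_nonneg _) (by norm_num)] at h2
  rw [h2, Real.sqrt_eq_rpow, one_div]

/-- Frees the norms from the arbitrary choice inside `weakDeriv`: any family of weak derivatives
computes them. -/
lemma derivNorm_two_eq {U D : Set (E n)} (hU : IsOpen U) (hD : D ⊆ U) {s : Finset (MultiIndex n)}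
    {u : E n → ℝ} {G : MultiIndex n → E n → ℝ} (h : ∀ α ∈ s, IsWeakDeriv U α u (G α)) :
    derivNorm U D s 2 u =
      (∑ α ∈ s, ∫⁻ x in D, ENNReal.ofReal (G α x ^ 2)) ^ (2⁻¹ : ℝ) := by
  unfold derivNorm
  rw [if_pos fun α hα => ⟨_, h α hα⟩, if_neg (by simp)]
  simp only [ENNReal.toReal_ofNat, one_div]
  congr 1
  refine Finset.sum_congr rfl fun α hα => ?_
  rw [← eLpNorm_two_sq]
  congr 1
  exact eLpNorm_congr_ae (ae_restrict_of_ae_restrict_of_subset hD ((h α hα).weakDeriv_ae_eq hU))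

lemma HasH1Gradient.mono {U V : Set (E n)} {u : E n → ℝ} {g : Fin n → E n → ℝ}
    (h : HasH1Gradient U u g) (hV : V ⊆ U) : HasH1Gradient V u g :=
  ⟨h.1.mono_measure (Measure.restrict_mono hV le_rfl),
    fun i => (h.2 i).mono_measure (Measure.restrict_mono hV le_rfl),
    fun i => (h.3 i).mono hV⟩

lemma HasH1Gradient.sub {U : Set (E n)} {u v : E n → ℝ} {g k : Fin n → E n → ℝ}
    (h : HasH1Gradient U u g) (h' : HasH1Gradient U v k) :
    HasH1Gradient U (fun x => u x - v x) (fun i x => g i x - k i x) := by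
  refine ⟨h.1.sub h'.1, fun i => (h.2 i).sub (h'.2 i), fun i => ⟨(h.3 i).1.sub (h'.3 i).1,
    (h.3 i).2.sub (h'.3 i).2, fun φ hφ hc hs => ?_⟩⟩
  have int : ∀ f ψ : E n → ℝ, MemLp f 2 (volume.restrict U) → Continuous ψ →
      HasCompactSupport ψ → Integrable (fun x => f x * ψ x) (volume.restrict U) :=
    fun f ψ hf hψ hψ' => hf.integrable_mul (hψ.memLp_of_hasCompactSupport hψ' (p := 2))
  have hd : Continuous (multiDeriv (Pi.single i 1) φ) ∧
      HasCompactSupport (multiDeriv (Pi.single i 1) φ) := by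
    rw [multiDeriv_single]
    exact ⟨(hφ.continuous_fderiv (by simp)).clm_apply continuous_const, hc.fderiv_apply ℝ _⟩
  have e1 := (h.3 i).3 φ hφ hc hs
  have e2 := (h'.3 i).3 φ hφ hc hs
  simp only [sub_mul]
  rw [integral_sub (int _ _ h.1 hd.1 hd.2) (int _ _ h'.1 hd.1 hd.2),
    integral_sub (int _ _ (h.2 i) hφ.continuous hc) (int _ _ (h'.2 i) hφ.continuous hc),
    e1, e2, mul_sub]

lemma lintegral_energy {μ : Measure (E n)} {u : E n → ℝ} {g : Fin n → E n → ℝ}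
    (hg : ∀ i, AEMeasurable (g i) μ) :
    ∫⁻ x, ENNReal.ofReal (energy u g x) ∂μ = ∫⁻ x, ENNReal.ofReal (u x ^ 2) ∂μ +
      ∑ i, ∫⁻ x, ENNReal.ofReal (g i x ^ 2) ∂μ := by
  rw [← lintegral_finsetSum' _ fun i _ => ((hg i).pow_const 2).ennreal_ofReal,
    ← lintegral_add_right' _
      (Finset.aemeasurable_fun_sum _ fun i _ => ((hg i).pow_const 2).ennreal_ofReal)]
  refine lintegral_congr fun x => ?_
  rw [energy, ENNReal.ofReal_add (sq_nonneg _) (Finset.sum_nonneg fun _ _ => sq_nonneg _),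
    ENNReal.ofReal_sum_of_nonneg fun _ _ => sq_nonneg _]

lemma HasH1Gradient.h1NormOn_eq {U D : Set (E n)} {u : E n → ℝ} {g : Fin n → E n → ℝ}
    (h : HasH1Gradient U u g) (hU : IsOpen U) (hD : D ⊆ U) :
    h1NormOn U D u = (∫⁻ x in D, ENNReal.ofReal (energy u g x)) ^ (2⁻¹ : ℝ) := by
  classical
  -- The pair `u`, `g` is repackaged as a family over multi-indices; injectivity of `Pi.single · 1`
  -- makes the chosen index the right one.
  have hw : ∀ α ∈ multiIndicesLE n 1, IsWeakDeriv U α u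
      (if hα : ∃ i : Fin n, (Pi.single i 1 : MultiIndex n) = α then g hα.choose else u) := by
    intro α hα
    rw [multiIndicesLE_one, Finset.mem_insert, Finset.mem_image] at hα
    split_ifs with hi
    · have := h.3 hi.choose
      rwa [hi.choose_spec] at this
    · rcases hα with rfl | ⟨i, -, hi'⟩
      · exact isWeakDeriv_zero (locallyIntegrableOn_of_memLp_two h.1)
      · exact absurd ⟨i, hi'⟩ hi
  have hind : ∀ i : Fin n, (if hα : ∃ j : Fin n, (Pi.single j 1 : MultiIndex n) = Pi.single i 1
      then g hα.choose else u) = g i := by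
    intro i
    have hi : ∃ j : Fin n, (Pi.single j 1 : MultiIndex n) = Pi.single i 1 := ⟨i, rfl⟩
    rw [dif_pos hi, single_injective hi.choose_spec]
  have h0 : ¬ ∃ j : Fin n, (Pi.single j 1 : MultiIndex n) = 0 := fun ⟨j, hj⟩ =>
    zero_notMem_image_single (Finset.mem_image.2 ⟨j, Finset.mem_univ _, hj⟩)
  rw [h1NormOn, derivNorm_two_eq hU hD hw, multiIndicesLE_one,
    Finset.sum_insert zero_notMem_image_single, Finset.sum_image single_injective.injOn]
  simp only [hind]
  rw [dif_neg h0, lintegral_energy fun i =>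
    ((h.2 i).1.mono_measure (Measure.restrict_mono hD le_rfl)).aemeasurable]

lemma HasH1Gradient.integrable_energy {U : Set (E n)} {u : E n → ℝ} {g : Fin n → E n → ℝ}
    (h : HasH1Gradient U u g) : IntegrableOn (energy u g) U :=
  h.1.integrable_sq.add (integrable_finsetSum _ fun i _ => (h.2 i).integrable_sq)

lemma HasH1Gradient.sobolevNorm_eq {U : Set (E n)} {u : E n → ℝ} {g : Fin n → E n → ℝ}
    (h : HasH1Gradient U u g) (hU : IsOpen U) :
    sobolevNorm U 1 2 u = ENNReal.ofReal (√(∫ x in U, energy u g x)) := by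
  have := h.h1NormOn_eq hU subset_rfl
  rw [← ofReal_integral_eq_lintegral_ofReal h.integrable_energy
    (ae_of_all _ fun _ => energy_nonneg _ _ _), ENNReal.ofReal_rpow_of_nonneg
    (integral_nonneg fun _ => energy_nonneg _ _ _) (by norm_num)] at this
  rw [Real.sqrt_eq_rpow, one_div]
  exact this

lemma HasH1Gradient.gradNorm_eq {U : Set (E n)} {u : E n → ℝ} {g : Fin n → E n → ℝ}
    (h : HasH1Gradient U u g) (hU : IsOpen U) :
    gradNorm U u = ENNReal.ofReal (√(∫ x in U, ∑ i, g i x ^ 2)) := by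
  classical
  have hw : ∀ α ∈ Finset.univ.image (fun i : Fin n => (Pi.single i 1 : MultiIndex n)),
      IsWeakDeriv U α u
        (if hα : ∃ i : Fin n, (Pi.single i 1 : MultiIndex n) = α then g hα.choose else u) := by
    intro α hα
    obtain ⟨i, -, hi⟩ := Finset.mem_image.1 hα
    have hi' : ∃ i : Fin n, (Pi.single i 1 : MultiIndex n) = α := ⟨i, hi⟩
    rw [dif_pos hi']
    have := h.3 hi'.choose
    rwa [hi'.choose_spec] at this
  have hind : ∀ i : Fin n, (if hα : ∃ j : Fin n, (Pi.single j 1 : MultiIndex n) = Pi.single i 1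
      then g hα.choose else u) = g i := by
    intro i
    have hi : ∃ j : Fin n, (Pi.single j 1 : MultiIndex n) = Pi.single i 1 := ⟨i, rfl⟩
    rw [dif_pos hi, single_injective hi.choose_spec]
  rw [gradNorm, derivNorm_two_eq hU subset_rfl hw, Finset.sum_image single_injective.injOn]
  simp only [hind]
  rw [integral_finsetSum _ fun i _ => (h.2 i).integrable_sq, Real.sqrt_eq_rpow, one_div,
    ← ENNReal.ofReal_rpow_of_nonneg (Finset.sum_nonneg fun i _ => integral_nonneg fun _ =>
      sq_nonneg _) (by norm_num), ENNReal.ofReal_sum_of_nonneg fun i _ => integral_nonneg fun _ =>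
      sq_nonneg _]
  congr 1
  refine Finset.sum_congr rfl fun i _ => ?_
  rw [ofReal_integral_eq_lintegral_ofReal (h.2 i).integrable_sq (ae_of_all _ fun _ => sq_nonneg _)]

lemma sobolevNorm_zero_two_eq {U : Set (E n)} (hU : IsOpen U) {u : E n → ℝ}
    (h : MemLp u 2 (volume.restrict U)) :
    sobolevNorm U 0 2 u = ENNReal.ofReal (√(∫ x in U, u x ^ 2)) := by
  rw [sobolevNorm, multiIndicesLE_zero, derivNorm_two_eq hU subset_rfl (G := fun _ => u)]
  · rw [Finset.sum_singleton, ← ofReal_integral_eq_lintegral_ofReal h.integrable_sq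
      (ae_of_all _ fun _ => sq_nonneg _), ENNReal.ofReal_rpow_of_nonneg
      (integral_nonneg fun _ => sq_nonneg _) (by norm_num), Real.sqrt_eq_rpow, one_div]
  · intro α hα
    rw [Finset.mem_singleton.1 hα]
    exact isWeakDeriv_zero (locallyIntegrableOn_of_memLp_two h)

lemma HasH1Gradient.mem_H1 {U : Set (E n)} {u : E n → ℝ} {g : Fin n → E n → ℝ}
    (h : HasH1Gradient U u g) (hU : IsOpen U) : u ∈ H1 U := by
  show sobolevNorm U 1 2 u < ⊤
  rw [h.sobolevNorm_eq hU]
  exact ENNReal.ofReal_lt_top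

lemma hasH1Gradient_of_mem_H1 {U : Set (E n)} (hU : IsOpen U) {u : E n → ℝ} (h : u ∈ H1 U) :
    HasH1Gradient U u (fun i => weakPartial U i u) := by
  have h' : derivNorm U U (multiIndicesLE n 1) 2 u < ⊤ := h
  unfold derivNorm at h'
  split_ifs at h' with hw h2
  · simp at h2
  · have hfin : ∀ α ∈ multiIndicesLE n 1,
        eLpNorm (weakDeriv U α u) 2 (volume.restrict U) < ⊤ := by
      intro α hα
      have h3 := (ENNReal.rpow_lt_top_iff_of_pos (by norm_num)).1 h'
      have h4 := (ENNReal.sum_lt_top.1 h3) α hα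
      exact (ENNReal.rpow_lt_top_iff_of_pos (by norm_num)).1 h4
    have hmem : ∀ α ∈ multiIndicesLE n 1,
        MemLp (weakDeriv U α u) 2 (volume.restrict U) := fun α hα =>
      ⟨(isWeakDeriv_weakDeriv (hw α hα)).2.aestronglyMeasurable, hfin α hα⟩
    have h0 : (0 : MultiIndex n) ∈ multiIndicesLE n 1 := by
      rw [multiIndicesLE_one]; exact Finset.mem_insert_self _ _
    have hi : ∀ i : Fin n, (Pi.single i 1 : MultiIndex n) ∈ multiIndicesLE n 1 := fun i => by
      rw [multiIndicesLE_one]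
      exact Finset.mem_insert_of_mem (Finset.mem_image_of_mem _ (Finset.mem_univ i))
    refine ⟨?_, fun i => hmem _ (hi i), fun i => isWeakDeriv_weakDeriv (hw _ (hi i))⟩
    refine (memLp_congr_ae ?_).1 (hmem 0 h0)
    exact (isWeakDeriv_zero (isWeakDeriv_weakDeriv (hw 0 h0)).1).weakDeriv_ae_eq hU
  · simp at h'

lemma HasH1Gradient.ae_eq_zero {U : Set (E n)} (hU : IsOpen U) {u : E n → ℝ}
    {g : Fin n → E n → ℝ} (h : HasH1Gradient U u g) (h0 : u =ᵐ[volume.restrict U] 0) (i : Fin n) :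
    g i =ᵐ[volume.restrict U] 0 :=
  (h.3 i).ae_unique hU ⟨locallyIntegrable_zero.locallyIntegrableOn _,
    locallyIntegrable_zero.locallyIntegrableOn _, fun φ _ _ _ => by simp⟩ h0

/-! ### Multiplication by smooth functions -/

lemma memLp_mul_of_eq_zero_off {U₀ U : Set (E n)} (hU₀ : IsOpen U₀) (hU : IsOpen U)
    {a f : E n → ℝ} {M : ℝ} (ha : ContinuousOn a U₀) (hM : ∀ x ∈ U₀, |a x| ≤ M)
    (h0 : ∀ x ∈ U, x ∉ U₀ → a x = 0) (hf : MemLp f 2 (volume.restrict U₀)) :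
    MemLp (fun x => a x * f x) 2 (volume.restrict U) := by
  have h1 : MemLp (fun x => a x * f x) 2 (volume.restrict U₀) := by
    refine hf.of_le_mul (c := M)
      ((ha.aestronglyMeasurable hU₀.measurableSet).mul hf.aestronglyMeasurable) ?_
    filter_upwards [ae_restrict_mem hU₀.measurableSet] with x hx
    rw [norm_mul]
    exact mul_le_mul_of_nonneg_right (hM x hx) (norm_nonneg _)
  have h2 := ((memLp_indicator_iff_restrict hU₀.measurableSet).2 h1).restrict U
  refine (memLp_congr_ae ?_).1 h2
  filter_upwards [ae_restrict_mem hU.measurableSet] with x hx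
  by_cases hx' : x ∈ U₀
  · rw [indicator_of_mem hx']
  · rw [indicator_of_notMem hx', h0 x hx hx', zero_mul]

lemma partialDeriv_eq_zero_of_notMem_tsupport {f : E n → ℝ} {x : E n} (hx : x ∉ tsupport f)
    (i : Fin n) : partialDeriv i f x = 0 := by
  simp [partialDeriv, fderiv_of_notMem_tsupport (𝕜 := ℝ) hx]

lemma contDiff_mul_of_tsupport_subset {U : Set (E n)} (hU : IsOpen U) {ζ φ : E n → ℝ}
    (hζ : ContDiffOn ℝ ∞ ζ U) (hφ : ContDiff ℝ ∞ φ) (hs : tsupport φ ⊆ U) :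
    ContDiff ℝ ∞ fun x => ζ x * φ x := by
  rw [contDiff_iff_contDiffAt]
  intro x
  by_cases hx : x ∈ U
  · exact (hζ.contDiffAt (hU.mem_nhds hx)).mul hφ.contDiffAt
  · have h0 : (fun x => ζ x * φ x) =ᶠ[𝓝 x] fun _ => 0 := by
      filter_upwards [notMem_tsupport_iff_eventuallyEq.1 fun h => hx (hs h)] with y hy
      simp [hy]
    exact contDiffAt_const.congr_of_eventuallyEq h0

lemma partialDeriv_mul {ζ φ : E n → ℝ} {x : E n} (hζ : DifferentiableAt ℝ ζ x)
    (hφ : DifferentiableAt ℝ φ x) (i : Fin n) :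
    partialDeriv i (fun y => ζ y * φ y) x =
      ζ x * partialDeriv i φ x + partialDeriv i ζ x * φ x := by
  simp only [partialDeriv]
  rw [fderiv_fun_mul hζ hφ]
  simp [mul_comm]

lemma continuousOn_partialDeriv {U : Set (E n)} (hU : IsOpen U) {ζ : E n → ℝ}
    (hζ : ContDiffOn ℝ ∞ ζ U) (i : Fin n) : ContinuousOn (partialDeriv i ζ) U :=
  (hζ.continuousOn_fderiv_of_isOpen hU (by simp)).clm_apply continuousOn_const

/-- Product rule and extension by zero at once: `u` is known only on `U₀`, but if `φ` is a test
function on `U` then `ζφ` is one on `U₀`, because `ζ` is supported there relative to `U`. The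
support of `ζ` may reach the boundary of `U`. -/
lemma HasH1Gradient.mul_smooth {U₀ U : Set (E n)} (hU₀ : IsOpen U₀) (hU : IsOpen U)
    (hsub : U₀ ⊆ U) {u ζ : E n → ℝ} {g : Fin n → E n → ℝ} (h : HasH1Gradient U₀ u g)
    (hζ : ContDiffOn ℝ ∞ ζ U) {M : ℝ} (hM : ∀ x ∈ U, |ζ x| ≤ M)
    (hM' : ∀ x ∈ U, ∀ i, |partialDeriv i ζ x| ≤ M) (hsupp : tsupport ζ ∩ U ⊆ U₀) :
    HasH1Gradient U (fun x => ζ x * u x)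
      (fun i x => ζ x * g i x + partialDeriv i ζ x * u x) := by
  have hc0 : ContinuousOn ζ U₀ := hζ.continuousOn.mono hsub
  have hc1 : ∀ i, ContinuousOn (partialDeriv i ζ) U₀ := fun i =>
    (continuousOn_partialDeriv hU hζ i).mono hsub
  have hz0 : ∀ x ∈ U, x ∉ U₀ → ζ x = 0 := fun x hx hx' =>
    image_eq_zero_of_notMem_tsupport fun h => hx' (hsupp ⟨h, hx⟩)
  have hz1 : ∀ i, ∀ x ∈ U, x ∉ U₀ → partialDeriv i ζ x = 0 := fun i x hx hx' =>
    partialDeriv_eq_zero_of_notMem_tsupport (fun h => hx' (hsupp ⟨h, hx⟩)) i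
  have hm : ∀ f, MemLp f 2 (volume.restrict U₀) →
      MemLp (fun x => ζ x * f x) 2 (volume.restrict U) := fun f hf =>
    memLp_mul_of_eq_zero_off hU₀ hU hc0 (fun x hx => hM x (hsub hx)) hz0 hf
  have hm' : ∀ i f, MemLp f 2 (volume.restrict U₀) →
      MemLp (fun x => partialDeriv i ζ x * f x) 2 (volume.restrict U) := fun i f hf =>
    memLp_mul_of_eq_zero_off hU₀ hU (hc1 i) (fun x hx => hM' x (hsub hx) i) (hz1 i) hf
  have hmg : ∀ i, MemLp (fun x => ζ x * g i x + partialDeriv i ζ x * u x) 2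
      (volume.restrict U) := fun i => (hm _ (h.2 i)).add (hm' i _ h.1)
  refine ⟨hm _ h.1, hmg, fun i => ⟨locallyIntegrableOn_of_memLp_two (hm _ h.1),
    locallyIntegrableOn_of_memLp_two (hmg i), fun φ hφ hc hs => ?_⟩⟩
  have hψ := contDiff_mul_of_tsupport_subset hU hζ hφ hs
  have hψc : HasCompactSupport fun x => ζ x * φ x := hc.mul_left
  have hψs : tsupport (fun x => ζ x * φ x) ⊆ U₀ := fun x hx => by
    have h1 : x ∈ tsupport ζ := closure_mono (fun y hy => left_ne_zero_of_mul hy) hx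
    have h2 : x ∈ tsupport φ := closure_mono (fun y hy => right_ne_zero_of_mul hy) hx
    exact hsupp ⟨h1, hs h2⟩
  have key := (h.3 i).3 _ hψ hψc hψs
  have int : ∀ f θ : E n → ℝ, MemLp f 2 (volume.restrict U₀) → Continuous θ →
      HasCompactSupport θ → Integrable (fun x => f x * θ x) (volume.restrict U₀) :=
    fun f θ hf hθ hθ' => hf.integrable_mul (hθ.memLp_of_hasCompactSupport hθ' (p := 2))
  rw [multiDeriv_single, order_single] at key ⊢
  have hrU : ∀ f : E n → ℝ, (∀ x ∈ U, x ∉ U₀ → f x = 0) → ∫ x in U, f x = ∫ x in U₀, f x :=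
    fun f hf => setIntegral_eq_of_subset_of_forall_sdiff_eq_zero hU.measurableSet hsub
      fun x hx => hf x hx.1 hx.2
  rw [hrU _ fun x hx hx' => by simp [hz0 x hx hx'],
    hrU _ fun x hx hx' => by simp [hz0 x hx hx', hz1 i x hx hx']]
  have hd : ∀ x ∈ U₀, partialDeriv i (fun x => ζ x * φ x) x =
      ζ x * partialDeriv i φ x + partialDeriv i ζ x * φ x := fun x hx =>
    partialDeriv_mul ((hζ.contDiffAt (hU.mem_nhds (hsub hx))).differentiableAt (by simp))
      (hφ.differentiable (by simp) x) i
  have hpφ : Continuous (partialDeriv i φ) ∧ HasCompactSupport (partialDeriv i φ) :=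
    ⟨(hφ.continuous_fderiv (by simp)).clm_apply continuous_const, hc.fderiv_apply ℝ _⟩
  have hmono : ∀ f : E n → ℝ, MemLp f 2 (volume.restrict U) → MemLp f 2 (volume.restrict U₀) :=
    fun f hf => hf.mono_measure (Measure.restrict_mono hsub le_rfl)
  have i1 := int _ _ (hmono _ (hm _ h.1)) hpφ.1 hpφ.2
  have i2 := int _ _ (hmono _ (hm' i _ h.1)) hφ.continuous hc
  have i3 := int _ _ (hmono _ (hm _ (h.2 i))) hφ.continuous hc
  have e1 : ∫ x in U₀, u x * partialDeriv i (fun x => ζ x * φ x) x =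
      (∫ x in U₀, ζ x * u x * partialDeriv i φ x) +
        ∫ x in U₀, partialDeriv i ζ x * u x * φ x := by
    rw [← integral_add i1 i2]
    refine setIntegral_congr_fun hU₀.measurableSet fun x hx => ?_
    simp only [hd x hx]
    ring
  have e2 : ∫ x in U₀, (ζ x * g i x + partialDeriv i ζ x * u x) * φ x =
      (∫ x in U₀, g i x * (ζ x * φ x)) + ∫ x in U₀, partialDeriv i ζ x * u x * φ x := by
    have e3 : ∫ x in U₀, g i x * (ζ x * φ x) = ∫ x in U₀, ζ x * g i x * φ x :=
      integral_congr_ae (ae_of_all _ fun x => by ring)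
    rw [e3, ← integral_add i3 i2]
    exact integral_congr_ae (ae_of_all _ fun x => by ring)
  rw [e2]
  rw [e1] at key
  linarith

/-- Combined with `HasH1Gradient.mul_smooth`, this puts the cutoff itself into `H¹(Ω)`, as
superapproximation requires. -/
lemma hasH1Gradient_one {U : Set (E n)} (hb : Bornology.IsBounded U) :
    HasH1Gradient U (fun _ => 1) (fun _ _ => 0) := by
  have : IsFiniteMeasure (volume.restrict U) := ⟨by
    rw [Measure.restrict_apply_univ]; exact hb.measure_lt_top⟩
  have hm : MemLp (fun _ : E n => (1 : ℝ)) 2 (volume.restrict U) := memLp_const 1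
  refine ⟨hm, fun _ => MemLp.zero', fun i => ⟨locallyIntegrableOn_of_memLp_two hm,
    locallyIntegrable_zero.locallyIntegrableOn _, fun φ hφ hc hs => ?_⟩⟩
  have hpφ : Continuous (partialDeriv i φ) ∧ HasCompactSupport (partialDeriv i φ) :=
    ⟨(hφ.continuous_fderiv (by simp)).clm_apply continuous_const, hc.fderiv_apply ℝ _⟩
  rw [multiDeriv_single]
  simp only [one_mul, zero_mul, integral_zero, mul_zero]
  rw [setIntegral_eq_integral_of_forall_compl_eq_zero fun x hx =>
    partialDeriv_eq_zero_of_notMem_tsupport (fun h => hx (hs h)) i]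
  have := integral_mul_fderiv_eq_neg_fderiv_mul_of_integrable (μ := (volume : Measure (E n)))
    (f := fun _ => (1 : ℝ)) (g := φ) (v := EuclideanSpace.single i 1) (by simp)
    (by simp only [one_mul]; exact hpφ.1.integrable_of_hasCompactSupport hpφ.2)
    (by simp only [one_mul]; exact hφ.continuous.integrable_of_hasCompactSupport hc)
    (fun x _ => differentiableAt_const _) (fun x _ => hφ.differentiable (by simp) x)
  simpa [partialDeriv] using this

/-! ### Cutoff functions -/

/-- Translates and dilates of one fixed bump, so that `K` depends on `n` and `r` only. The outer
radius `3/16 < 1/4` leaves room for the closed support inside the open ball. -/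
lemma exists_cutoff (n r : ℕ) : ∃ K : ℝ, 0 < K ∧ ∀ (z : E n) (d : ℝ), 0 < d →
    ∃ η : E n → ℝ, ContDiff ℝ ∞ η ∧ (∀ x, 0 ≤ η x) ∧ (∀ x, η x ≤ 1) ∧
      (∀ x ∈ Metric.ball z (d / 8), η x = 1) ∧ tsupport η ⊆ Metric.ball z (d / 4) ∧
      ∀ j ≤ r, ∀ x, ‖iteratedFDeriv ℝ j η x‖ ≤ K / d ^ j := by
  let ψ : ContDiffBump (0 : E n) := ⟨1 / 8, 3 / 16, by norm_num, by norm_num⟩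
  have hψ : ContDiff ℝ ∞ (ψ : E n → ℝ) := ψ.contDiff
  have hb : ∀ j : ℕ, ∃ K : ℝ, ∀ x, ‖iteratedFDeriv ℝ j (ψ : E n → ℝ) x‖ ≤ K := fun j =>
    (ψ.hasCompactSupport.iteratedFDeriv j).exists_bound_of_continuous
      (hψ.continuous_iteratedFDeriv (by exact_mod_cast le_top))
  choose K hK using hb
  have hK0 : ∀ j, 0 ≤ K j := fun j => (norm_nonneg _).trans (hK j 0)
  refine ⟨1 + ∑ j ∈ Finset.range (r + 1), K j, by
    have := Finset.sum_nonneg fun j (_ : j ∈ Finset.range (r + 1)) => hK0 j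
    linarith, fun z d hd => ?_⟩
  set L : E n →L[ℝ] E n := d⁻¹ • ContinuousLinearMap.id ℝ (E n)
  have hL : ‖L‖ ≤ d⁻¹ := by
    refine (norm_smul_le (d⁻¹) (ContinuousLinearMap.id ℝ (E n))).trans ?_
    rw [Real.norm_of_nonneg (inv_nonneg.2 hd.le)]
    exact mul_le_of_le_one_right (inv_nonneg.2 hd.le) ContinuousLinearMap.norm_id_le
  have hLx : ∀ x, ‖L (x - z)‖ = dist x z / d := fun x => by
    simp [L, norm_smul, abs_of_pos hd, dist_eq_norm, div_eq_inv_mul]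
  have hcont : Continuous fun x => L (x - z) := by fun_prop
  refine ⟨fun x => ψ (L (x - z)), hψ.comp (L.contDiff.comp (contDiff_id.sub contDiff_const)),
    fun x => ψ.nonneg, fun x => ψ.le_one, fun x hx => ?_, ?_, fun j hj x => ?_⟩
  · refine ψ.one_of_mem_closedBall ?_
    rw [mem_closedBall_zero_iff, hLx, div_le_iff₀ hd]
    have := Metric.mem_ball.1 hx
    show dist x z ≤ 1 / 8 * d
    linarith
  · have hsub : tsupport (fun x => ψ (L (x - z))) ⊆ Metric.closedBall z (3 / 16 * d) := by
      refine closure_minimal (fun x hx => ?_) Metric.isClosed_closedBall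
      have h1 : L (x - z) ∈ Function.support (ψ : E n → ℝ) := hx
      rw [ψ.support_eq, mem_ball_zero_iff, hLx, div_lt_iff₀ hd] at h1
      exact Metric.mem_closedBall.2 h1.le
    exact hsub.trans (Metric.closedBall_subset_ball (by linarith))
  · have e1 : iteratedFDeriv ℝ j (fun x => ψ (L (x - z))) x =
        (iteratedFDeriv ℝ j (ψ : E n → ℝ) (L (x - z))).compContinuousLinearMap fun _ => L := by
      have h1 := iteratedFDeriv_comp_sub (𝕜 := ℝ) (f := fun y => ψ (L y)) j z x
      rw [h1]
      exact L.iteratedFDeriv_comp_right hψ (x - z) (by exact_mod_cast le_top)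
    rw [e1]
    refine (ContinuousMultilinearMap.norm_compContinuousLinearMap_le _ _).trans ?_
    rw [Finset.prod_const, Finset.card_univ, Fintype.card_fin, div_eq_mul_inv, ← inv_pow]
    refine mul_le_mul ((hK j _).trans ?_) (pow_le_pow_left₀ (norm_nonneg _) hL j)
      (by positivity) ?_
    · have := Finset.single_le_sum (fun j (_ : j ∈ Finset.range (r + 1)) => hK0 j)
        (Finset.mem_range.2 (Nat.lt_succ_of_le hj))
      linarith
    · have := Finset.sum_nonneg fun j (_ : j ∈ Finset.range (r + 1)) => hK0 j
      linarith

/-- A smooth bump around `z`, cut off outside `G`, is smooth on `Ω` if the part of the frontier of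
`G` near `z` lies on the frontier of `Ω`. -/
lemma exists_cutoff_inter (n r : ℕ) : ∃ K : ℝ, 0 < K ∧ ∀ (z : E n) (d : ℝ), 0 < d →
    ∀ Ω G : Set (E n), IsOpen Ω → G ⊆ Ω → Metric.ball z d ∩ frontier G ⊆ frontier Ω →
    ∃ ζ : E n → ℝ, ContDiffOn ℝ ∞ ζ Ω ∧ (∀ x, 0 ≤ ζ x) ∧ (∀ x, ζ x ≤ 1) ∧
      (∀ x ∈ Metric.ball z (d / 8) ∩ G, ζ x = 1) ∧
      (∀ x ∈ Metric.ball z (d / 8) ∩ G, ∀ i, partialDeriv i ζ x = 0) ∧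
      tsupport ζ ∩ Ω ⊆ Metric.ball z (d / 4) ∩ G ∧
      (∀ x ∉ Metric.ball z (d / 4) ∩ G, ζ x = 0) ∧
      (∀ j ≤ r, ∀ x ∈ Ω, ‖iteratedFDeriv ℝ j ζ x‖ ≤ K / d ^ j) ∧
      (∀ x ∈ Ω, ∀ i, |partialDeriv i ζ x| ≤ K / d) := by
  -- One derivative more than asked for, so that the gradient of `ζ` is controlled even when `r =
  -- 0`.
  obtain ⟨K, hK, hη⟩ := exists_cutoff n (r + 1)
  refine ⟨K, hK, fun z d hd Ω G hΩ hG hfr => ?_⟩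
  obtain ⟨η, h1, h2, h3, h4, h5, h6⟩ := hη z d hd
  have hint : ∀ x ∈ Ω, x ∈ Metric.ball z d → x ∉ frontier G := fun x hx hxb hxf => by
    have := hfr ⟨hxb, hxf⟩
    rw [hΩ.frontier_eq] at this
    exact this.2 hx
  have hball : Metric.ball z (d / 4) ⊆ Metric.ball z d := Metric.ball_subset_ball (by linarith)
  set ζ := G.indicator η with hζ
  -- On the support of `η` no point of `Ω` is a frontier point of `G`; hence near each point of `Ω`
  -- the truncated bump is either `η` or zero.
  have hloc : ∀ x ∈ Ω, (x ∈ G ∧ x ∈ tsupport η ∧ ζ =ᶠ[𝓝 x] η) ∨ ζ =ᶠ[𝓝 x] fun _ => 0 := by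
    intro x hx
    by_cases hxt : x ∈ tsupport η
    · have hxf := hint x hx (hball (h5 hxt))
      by_cases hxG : x ∈ G
      · left
        refine ⟨hxG, hxt, ?_⟩
        have : x ∈ interior G := by
          by_contra hni
          exact hxf ⟨subset_closure hxG, hni⟩
        filter_upwards [mem_interior_iff_mem_nhds.1 this] with y hy
        exact indicator_of_mem hy η
      · right
        have : x ∉ closure G := fun hc => hxf ⟨hc, fun hi => hxG (interior_subset hi)⟩
        filter_upwards [isClosed_closure.isOpen_compl.mem_nhds this] with y hy
        exact indicator_of_notMem (fun hy' => hy (subset_closure hy')) η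
    · right
      filter_upwards [notMem_tsupport_iff_eventuallyEq.1 hxt] with y hy
      by_cases hyG : y ∈ G
      · rw [hζ, indicator_of_mem hyG, hy, Pi.zero_apply]
      · rw [hζ, indicator_of_notMem hyG]
  have hit : ∀ j ≤ r + 1, ∀ x ∈ Ω, ‖iteratedFDeriv ℝ j ζ x‖ ≤ K / d ^ j := by
    intro j hj x hx
    rcases hloc x hx with ⟨-, -, h⟩ | h
    · rw [h.iteratedFDeriv ℝ j |>.eq_of_nhds]
      exact h6 j hj x
    · rw [h.iteratedFDeriv ℝ j |>.eq_of_nhds]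
      have : iteratedFDeriv ℝ j (fun _ : E n => (0 : ℝ)) x = 0 := by
        have := iteratedFDeriv_fun_zero (𝕜 := ℝ) (E := E n) (F := ℝ) (n := j)
        exact congrFun this x
      rw [this, norm_zero]
      positivity
  refine ⟨ζ, fun x hx => ?_, fun x => indicator_nonneg (fun x _ => h2 x) x,
    fun x => (indicator_le_self' (fun x _ => h2 x) x).trans (h3 x), fun x hx => ?_,
    fun x hx i => ?_, fun x hx => ?_, fun x hx => ?_, fun j hj => hit j (by omega),
    fun x hx i => ?_⟩
  · rcases hloc x hx with ⟨-, -, h⟩ | h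
    · exact (h1.contDiffAt.congr_of_eventuallyEq h).contDiffWithinAt
    · exact (contDiffAt_const.congr_of_eventuallyEq h).contDiffWithinAt
  · rw [hζ, indicator_of_mem hx.2, h4 x hx.1]
  · have hone : ζ x = 1 := by rw [hζ, indicator_of_mem hx.2, h4 x hx.1]
    rcases hloc x (hG hx.2) with ⟨-, -, h⟩ | h
    · have h' : ζ =ᶠ[𝓝 x] fun _ => 1 := by
        filter_upwards [h, Metric.isOpen_ball.mem_nhds hx.1] with y hy hyb
        rw [hy, h4 y hyb]
      simp [partialDeriv, h'.fderiv_eq]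
    · exact absurd (h.eq_of_nhds.symm.trans hone) zero_ne_one
  · rcases hloc x hx.2 with ⟨hG, ht, -⟩ | h
    · exact ⟨h5 ht, hG⟩
    · exact absurd hx.1 (notMem_tsupport_iff_eventuallyEq.2 h)
  · by_cases hxG : x ∈ G
    · rw [hζ, indicator_of_mem hxG]
      exact image_eq_zero_of_notMem_tsupport fun ht => hx ⟨h5 ht, hxG⟩
    · rw [hζ, indicator_of_notMem hxG]
  · have h7 := hit 1 (by omega) x hx
    rw [norm_iteratedFDeriv_one, pow_one] at h7
    calc |partialDeriv i ζ x| ≤ ‖fderiv ℝ ζ x‖ * ‖(EuclideanSpace.single i (1 : ℝ) : E n)‖ :=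
          (fderiv ℝ ζ x).le_opNorm _
      _ ≤ K / d := by simpa using h7

/-! ### Geometry -/

/-- The local geometry uses the distance hypothesis only in this form. -/
lemma ball_inter_frontier_subset {Ω G : Set (E n)} {z : E n} {d : ℝ}
    (hz : ENNReal.ofReal d ≤ Metric.infEDist z (frontier G \ frontier Ω)) :
    Metric.ball z d ∩ frontier G ⊆ frontier Ω := by
  rintro y ⟨hy, hyG⟩
  by_contra hyΩ
  have h1 := hz.trans (Metric.infEDist_le_edist_of_mem (⟨hyG, hyΩ⟩ : y ∈ frontier G \ frontier Ω))
  rw [edist_dist, ENNReal.ofReal_le_ofReal_iff dist_nonneg, dist_comm] at h1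
  exact absurd (Metric.mem_ball.1 hy) (not_lt.2 h1)

lemma notMem_frontier_of_mem {Ω : Set (E n)} (hΩ : IsOpen Ω) {x : E n} (hx : x ∈ Ω) :
    x ∉ frontier Ω := fun h => by
  rw [hΩ.frontier_eq] at h
  exact h.2 hx

/-- A point of `G` lies in the open set `Ω`, hence not on `∂Ω`, so within the ball it must be
interior to `G`. -/
lemma isOpen_ball_inter {Ω G : Set (E n)} (hΩ : IsOpen Ω) (hG : G ⊆ Ω) {z : E n} {d r : ℝ}
    (hfr : Metric.ball z d ∩ frontier G ⊆ frontier Ω) (hr : r ≤ d) :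
    IsOpen (Metric.ball z r ∩ G) := by
  have : Metric.ball z r ∩ G = Metric.ball z r ∩ interior G := by
    refine Subset.antisymm (fun x hx => ⟨hx.1, ?_⟩) fun x hx => ⟨hx.1, interior_subset hx.2⟩
    by_contra hni
    exact notMem_frontier_of_mem hΩ (hG hx.2)
      (hfr ⟨Metric.ball_subset_ball hr hx.1, subset_closure hx.2, hni⟩)
  rw [this]
  exact Metric.isOpen_ball.inter isOpen_interior

lemma le_dist_of_mem_frontier {Ω G : Set (E n)} (hΩ : IsOpen Ω) (hG : G ⊆ Ω) {z : E n} {d r : ℝ}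
    (hfr : Metric.ball z d ∩ frontier G ⊆ frontier Ω) (hr : r ≤ d) {y : E n}
    (hy : y ∈ frontier (Metric.ball z r ∩ G) \ frontier Ω) : r ≤ dist y z := by
  by_contra! hlt
  have hyo := hy.1
  rw [(isOpen_ball_inter hΩ hG hfr hr).frontier_eq] at hyo
  have hcl : y ∈ closure G := closure_mono inter_subset_right hyo.1
  have hnot : y ∉ G := fun h => hyo.2 ⟨hlt, h⟩
  exact hy.2 (hfr ⟨Metric.mem_ball.2 (hlt.trans_le hr), hcl, fun hi => hnot (interior_subset hi)⟩)

/-- In a connected open set, the sets of points of `V` whose distance to the relative boundary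
of `V` exceeds `δ` have distance exactly `δ` from that boundary. -/
lemma setDist_eq_of_isPreconnected {Ω V : Set (E n)} (hΩ : IsOpen Ω) (hΩc : IsPreconnected Ω)
    (hV : IsOpen V) (hVΩ : V ⊆ Ω) (hne : V ≠ Ω) {δ : ℝ≥0∞}
    (hA : (V ∩ {x | δ < Metric.infEDist x (frontier V \ frontier Ω)}).Nonempty) :
    setDist (V ∩ {x | δ < Metric.infEDist x (frontier V \ frontier Ω)})
      (frontier V \ frontier Ω) = δ := by
  set F := frontier V \ frontier Ω
  set A := V ∩ {x | δ < Metric.infEDist x F}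
  refine le_antisymm ?_ (le_iInf₂ fun x hx => hx.2.le)
  by_contra! hlt
  have hAo : IsOpen A := hV.inter (isOpen_lt continuous_const Metric.continuous_infEDist)
  -- If the distance were larger than `δ`, the strict inequality would survive passage to the
  -- closure, so `A` would be relatively closed as well as open in the connected set `Ω`, forcing `V
  -- = Ω`.
  have hcl : closure A ∩ Ω ⊆ A := by
    rintro x ⟨hx, hxΩ⟩
    have hm : setDist A F ≤ Metric.infEDist x F := by
      have : A ⊆ {x | setDist A F ≤ Metric.infEDist x F} := fun y hy =>
        (iInf₂_le y hy : ⨅ x ∈ A, Metric.infEDist x F ≤ Metric.infEDist y F)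
      exact closure_minimal this (isClosed_le continuous_const Metric.continuous_infEDist) hx
    refine ⟨?_, hlt.trans_le hm⟩
    by_contra hxV
    have hxF : x ∈ F := by
      refine ⟨?_, notMem_frontier_of_mem hΩ hxΩ⟩
      rw [hV.frontier_eq]
      exact ⟨closure_mono inter_subset_left hx, hxV⟩
    rw [Metric.infEDist_zero_of_mem hxF] at hm
    exact absurd (hlt.trans_le hm) (not_lt.2 zero_le)
  obtain ⟨x, hx⟩ := hA
  have := hΩc.subset_of_closure_inter_subset hAo ⟨x, hVΩ hx.1, hx⟩ hcl
  exact hne (hVΩ.antisymm (this.trans inter_subset_left))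

/-- The element stays within `d/2 + d/4 < d` of `z`, so it misses the sphere, and inside `Ω` the set
`ball z d ∩ G` has no other frontier. A connected set that meets it therefore cannot leave it. -/
lemma subset_ball_inter_of_diam_le {Ω G T : Set (E n)} (hΩ : IsOpen Ω) (hG : G ⊆ Ω) {z : E n}
    {d : ℝ} (hfr : Metric.ball z d ∩ frontier G ⊆ frontier Ω) (hT : IsPreconnected T)
    (hTb : Bornology.IsBounded T) (hTΩ : T ⊆ Ω) (hmeet : (T ∩ (Metric.ball z (d / 2) ∩ G)).Nonempty)
    (hd : Metric.diam T ≤ d / 4) (hd0 : 0 < d) : T ⊆ Metric.ball z d ∩ G := by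
  obtain ⟨x, hxT, hxb, hxG⟩ := hmeet
  have hball : T ⊆ Metric.ball z d := fun y hy => by
    have h1 := Metric.dist_le_diam_of_mem hTb hy hxT
    have h2 := dist_triangle y x z
    have h3 := Metric.mem_ball.1 hxb
    exact Metric.mem_ball.2 (by linarith)
  refine hT.subset_of_closure_inter_subset (isOpen_ball_inter hΩ hG hfr le_rfl)
    ⟨x, hxT, hball hxT, hxG⟩ ?_
  rintro y ⟨hyc, hyT⟩
  by_contra hy
  have hyF : y ∈ frontier (Metric.ball z d ∩ G) \ frontier Ω := by
    refine ⟨?_, notMem_frontier_of_mem hΩ (hTΩ hyT)⟩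
    rw [(isOpen_ball_inter hΩ hG hfr le_rfl).frontier_eq]
    exact ⟨hyc, hy⟩
  exact absurd (Metric.mem_ball.1 (hball hyT)) (not_lt.2 (le_dist_of_mem_frontier hΩ hG hfr le_rfl hyF))

/-! ### Traces -/

/-- The means are dominated pointwise. Applied to `ζ²u`, where `0 ≤ ζ ≤ 1`, this shows that the
cutoff preserves the Dirichlet condition. -/
lemma TraceZero.of_abs_le {U Γ : Set (E n)} {u v : E n → ℝ} (h : TraceZero U Γ u)
    (hu : MemLp u 2 (volume.restrict U)) (hvu : ∀ x, |v x| ≤ |u x|) : TraceZero U Γ v := by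
  filter_upwards [h] with x hx hxΓ
  refine squeeze_zero (fun ρ => ?_) (fun ρ => ?_) (hx hxΓ)
  · rw [setAverage_eq]
    exact smul_nonneg (inv_nonneg.2 measureReal_nonneg) (integral_nonneg fun _ => abs_nonneg _)
  · rw [setAverage_eq, setAverage_eq]
    refine smul_le_smul_of_nonneg_left ?_ (inv_nonneg.2 measureReal_nonneg)
    refine integral_mono_of_nonneg (ae_of_all _ fun _ => abs_nonneg _) ?_ (ae_of_all _ hvu)
    have hfin : IsFiniteMeasure (volume.restrict (Metric.ball x ρ ∩ U)) := ⟨by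
      rw [Measure.restrict_apply_univ]
      exact (measure_mono inter_subset_left).trans_lt measure_ball_lt_top⟩
    have := hu.mono_measure (Measure.restrict_mono (inter_subset_right (s := Metric.ball x ρ)) le_rfl)
    exact (this.integrable one_le_two).abs

/-! ### The integrand of the bilinear form -/

/-- The integrand `A g · k + (b · g) v + c u v` of the bilinear form, for gradients `g`, `k`. -/
def Coeffs.density (P : Coeffs n) (u : E n → ℝ) (g : Fin n → E n → ℝ) (v : E n → ℝ)
    (k : Fin n → E n → ℝ) (x : E n) : ℝ :=
  (∑ i, ∑ j, P.A x i j * g j x * k i x) + (∑ i, P.b x i * g i x) * v x + P.c x * u x * v x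

/-- The coefficients are bounded by `Λ` at the point `x`. -/
def Coeffs.BoundedAt (P : Coeffs n) (Λ : ℝ) (x : E n) : Prop :=
  (∀ i j, |P.A x i j| ≤ Λ) ∧ (∀ i, |P.b x i| ≤ Λ) ∧ |P.c x| ≤ Λ

lemma Coeffs.Admissible.ae_boundedAt {P : Coeffs n} {U : Set (E n)} {Λ : ℝ}
    (h : P.Admissible U Λ) : ∀ᵐ x ∂(volume.restrict U), P.BoundedAt Λ x := by
  filter_upwards [h.bound_A, h.bound_b, h.bound_c] with x h1 h2 h3
  exact ⟨h1, fun i => (PiLp.norm_apply_le (P.b x) i).trans h2, h3⟩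

lemma Coeffs.Admissible.mono {P : Coeffs n} {U : Set (E n)} {Λ Λ' : ℝ} (h : P.Admissible U Λ)
    (hΛ : Λ ≤ Λ') : P.Admissible U Λ' := by
  refine ⟨h.1, h.2, h.3, ?_, ?_, ?_, h.7⟩
  · filter_upwards [h.4] with x hx i j using (hx i j).trans hΛ
  · filter_upwards [h.5] with x hx using hx.trans hΛ
  · filter_upwards [h.6] with x hx using hx.trans hΛ

lemma abs_sum_mul_mul_le {A : Fin n → Fin n → ℝ} {Λ : ℝ} (hA : ∀ i j, |A i j| ≤ Λ)
    (p q : Fin n → ℝ) :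
    |∑ i, ∑ j, A i j * p j * q i| ≤ Λ * ((∑ j, |p j|) * ∑ i, |q i|) := by
  calc |∑ i, ∑ j, A i j * p j * q i| ≤ ∑ i, ∑ j, |A i j * p j * q i| :=
        (Finset.abs_sum_le_sum_abs _ _).trans
          (Finset.sum_le_sum fun i _ => Finset.abs_sum_le_sum_abs _ _)
    _ ≤ ∑ i, ∑ j, Λ * (|p j| * |q i|) := by
        refine Finset.sum_le_sum fun i _ => Finset.sum_le_sum fun j _ => ?_
        rw [abs_mul, abs_mul, mul_assoc]
        exact mul_le_mul_of_nonneg_right (hA i j) (by positivity)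
    _ = Λ * ((∑ j, |p j|) * ∑ i, |q i|) := by
        rw [Finset.sum_mul_sum, Finset.mul_sum, Finset.sum_comm]
        simp_rw [Finset.mul_sum]

lemma abs_sum_mul_le {b : Fin n → ℝ} {Λ : ℝ} (hb : ∀ i, |b i| ≤ Λ) (p : Fin n → ℝ) :
    |∑ i, b i * p i| ≤ Λ * ∑ i, |p i| := by
  refine (Finset.abs_sum_le_sum_abs _ _).trans ?_
  rw [Finset.mul_sum]
  refine Finset.sum_le_sum fun i _ => ?_
  rw [abs_mul]
  exact mul_le_mul_of_nonneg_right (hb i) (abs_nonneg _)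

lemma sq_abs_add_sum_abs_le (a : ℝ) (p : Fin n → ℝ) :
    (|a| + ∑ i, |p i|) ^ 2 ≤ (n + 1) * (a ^ 2 + ∑ i, p i ^ 2) := by
  have h := sq_sum_le_card_mul_sum_sq (s := (Finset.univ : Finset (Option (Fin n))))
    (f := fun o => o.elim |a| fun i => |p i|)
  simp only [Fintype.sum_option, Option.elim, Finset.card_univ, Fintype.card_option,
    Fintype.card_fin, sq_abs] at h
  exact_mod_cast h

lemma Coeffs.abs_density_le {P : Coeffs n} {Λ t : ℝ} {x : E n} (hP : P.BoundedAt Λ x) (ht : 0 < t)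
    (hΛ : 0 ≤ Λ) (u : E n → ℝ) (g : Fin n → E n → ℝ) (v : E n → ℝ) (k : Fin n → E n → ℝ) :
    |P.density u g v k x| ≤ Λ * (n + 1) * (t * energy u g x + t⁻¹ * energy v k x) := by
  set a := |u x| + ∑ i, |g i x|
  set b := |v x| + ∑ i, |k i x|
  have ha : a ^ 2 ≤ (n + 1) * energy u g x := sq_abs_add_sum_abs_le (u x) fun i => g i x
  have hb : b ^ 2 ≤ (n + 1) * energy v k x := sq_abs_add_sum_abs_le (v x) fun i => k i x
  have h1 : |P.density u g v k x| ≤ Λ * (a * b) := by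
    have e1 := abs_sum_mul_mul_le hP.1 (fun j => g j x) fun i => k i x
    have e2 := mul_le_mul_of_nonneg_right (abs_sum_mul_le hP.2.1 fun j => g j x)
      (abs_nonneg (v x))
    have e3 : |P.c x * u x * v x| ≤ Λ * (|u x| * |v x|) := by
      rw [abs_mul, abs_mul, mul_assoc]
      exact mul_le_mul_of_nonneg_right hP.2.2 (by positivity)
    -- This product does not occur in the form; adding it completes the bound to the product `a *
    -- b`.
    have e4 : 0 ≤ |u x| * ∑ i, |k i x| :=
      mul_nonneg (abs_nonneg _) (Finset.sum_nonneg fun _ _ => abs_nonneg _)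
    rw [← abs_mul] at e2
    have e5 := abs_add_three (∑ i, ∑ j, P.A x i j * g j x * k i x)
      ((∑ i, P.b x i * g i x) * v x) (P.c x * u x * v x)
    have e6 : Λ * (a * b) = Λ * ((∑ i, |g i x|) * ∑ i, |k i x|) + Λ * (∑ i, |g i x|) * |v x| +
        Λ * (|u x| * |v x|) + Λ * (|u x| * ∑ i, |k i x|) := by
      simp only [a, b]; ring
    rw [e6]
    have e7 := mul_nonneg hΛ e4
    unfold Coeffs.density
    linarith
  have h2 : a * b ≤ t * a ^ 2 + t⁻¹ * b ^ 2 := by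
    have h3 : t * t⁻¹ = 1 := mul_inv_cancel₀ ht.ne'
    have h4 : 0 ≤ t⁻¹ := (inv_pos.2 ht).le
    have h5 : a * b = t * t⁻¹ * (a * b) := by rw [h3, one_mul]
    nlinarith [mul_nonneg h4 (sq_nonneg (t * a - b)), mul_nonneg ht.le (sq_nonneg a),
      mul_nonneg h4 (sq_nonneg b)]
  calc |P.density u g v k x| ≤ Λ * (a * b) := h1
    _ ≤ Λ * (t * ((n + 1) * energy u g x) + t⁻¹ * ((n + 1) * energy v k x)) := by
        refine mul_le_mul_of_nonneg_left (h2.trans ?_) hΛ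
        have h4 : 0 ≤ t⁻¹ := (inv_pos.2 ht).le
        exact add_le_add (mul_le_mul_of_nonneg_left ha ht.le) (mul_le_mul_of_nonneg_left hb h4)
    _ = _ := by ring

/-- The commutator of the form with the cutoff `ζ`: the density of `(ζ u, ζ u)` differs from that
of `(u, ζ² u)` by terms of lower order. -/
lemma Coeffs.abs_density_sub_le {P : Coeffs n} {Λ δ : ℝ} {x : E n} (hP : P.BoundedAt Λ x)
    (hδ : 0 < δ) (hΛ : 0 ≤ Λ) (u ζ : E n → ℝ) (g t : Fin n → E n → ℝ) {w : E n → ℝ}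
    {k : Fin n → E n → ℝ} (hw : w x = ζ x * u x) (hk : ∀ i, k i x = ζ x * g i x + t i x * u x) :
    |P.density w k w k x -
        P.density u g (fun y => ζ y * w y) (fun i y => ζ y * k i y + t i y * w y) x| ≤
      Λ * (n + 1) * (δ * energy w k x) + Λ * (δ⁻¹ + 1) * ((∑ i, |t i x|) ^ 2 * u x ^ 2) := by
  set τ := ∑ i, |t i x| with hτ
  have hτ0 : 0 ≤ τ := Finset.sum_nonneg fun _ _ => abs_nonneg _
  set s := ∑ i, |k i x| with hs
  have e1 := abs_sum_mul_mul_le hP.1 (fun j => t j x) fun i => k i x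
  have e2 := abs_sum_mul_mul_le hP.1 (fun j => k j x) fun i => t i x
  have e3 := abs_sum_mul_mul_le hP.1 (fun j => t j x) fun i => t i x
  have e4 := abs_sum_mul_le hP.2.1 fun i => t i x
  -- The zero-order terms cancel and the convection term leaves only `(b · t) u w`. The two mixed
  -- terms in `A` would cancel for symmetric `A`; here both are kept and estimated.
  have key : P.density w k w k x -
        P.density u g (fun y => ζ y * w y) (fun i y => ζ y * k i y + t i y * w y) x =
      u x * (∑ i, ∑ j, P.A x i j * t j x * k i x) - u x * (∑ i, ∑ j, P.A x i j * k j x * t i x) +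
        u x ^ 2 * (∑ i, ∑ j, P.A x i j * t j x * t i x) + (∑ i, P.b x i * t i x) * (u x * w x) := by
    have h1 : ∑ i, P.b x i * k i x =
        ζ x * (∑ i, P.b x i * g i x) + u x * ∑ i, P.b x i * t i x := by
      rw [Finset.mul_sum, Finset.mul_sum, ← Finset.sum_add_distrib]
      exact Finset.sum_congr rfl fun i _ => by rw [hk]; ring
    have h2 : (∑ i, ∑ j, P.A x i j * k j x * k i x) -
        (∑ i, ∑ j, P.A x i j * g j x * (ζ x * k i x + t i x * w x)) =
        u x * (∑ i, ∑ j, P.A x i j * t j x * k i x) -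
          u x * (∑ i, ∑ j, P.A x i j * k j x * t i x) +
          u x ^ 2 * (∑ i, ∑ j, P.A x i j * t j x * t i x) := by
      simp only [Finset.mul_sum, ← Finset.sum_sub_distrib, ← Finset.sum_add_distrib]
      refine Finset.sum_congr rfl fun i _ => Finset.sum_congr rfl fun j _ => ?_
      rw [hk j, hw]
      ring
    unfold Coeffs.density
    rw [h1]
    linear_combination h2 + (P.c x * w x) * hw
  have hR : |P.density w k w k x -
        P.density u g (fun y => ζ y * w y) (fun i y => ζ y * k i y + t i y * w y) x| ≤
      Λ * (2 * (τ * |u x|) * (|w x| + s) + τ ^ 2 * u x ^ 2) := by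
    rw [key]
    have hu := abs_nonneg (u x)
    have f1 : |u x * (∑ i, ∑ j, P.A x i j * t j x * k i x)| ≤ |u x| * (Λ * (τ * s)) := by
      rw [abs_mul]; exact mul_le_mul_of_nonneg_left e1 hu
    have f2 : |u x * (∑ i, ∑ j, P.A x i j * k j x * t i x)| ≤ |u x| * (Λ * (s * τ)) := by
      rw [abs_mul]; exact mul_le_mul_of_nonneg_left e2 hu
    have f3 : |u x ^ 2 * (∑ i, ∑ j, P.A x i j * t j x * t i x)| ≤ u x ^ 2 * (Λ * (τ * τ)) := by
      rw [abs_mul, abs_of_nonneg (sq_nonneg (u x))]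
      exact mul_le_mul_of_nonneg_left e3 (sq_nonneg _)
    have f4 : |(∑ i, P.b x i * t i x) * (u x * w x)| ≤ (Λ * τ) * (|u x| * |w x|) := by
      rw [abs_mul, abs_mul (u x)]; exact mul_le_mul_of_nonneg_right e4 (by positivity)
    have f5 : 0 ≤ Λ * τ * (|u x| * |w x|) := by positivity
    rw [abs_le] at f1 f2 f3 f4 ⊢
    constructor <;> nlinarith
  have hsw : (|w x| + s) ^ 2 ≤ (n + 1) * energy w k x :=
    sq_abs_add_sum_abs_le (w x) fun i => k i x
  have hy : 2 * (τ * |u x|) * (|w x| + s) ≤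
      δ⁻¹ * (τ ^ 2 * u x ^ 2) + δ * (|w x| + s) ^ 2 := by
    have h3 : δ * δ⁻¹ = 1 := mul_inv_cancel₀ hδ.ne'
    have h4 : 0 ≤ δ⁻¹ := (inv_pos.2 hδ).le
    have h5 : 0 ≤ δ⁻¹ * (τ * |u x| - δ * (|w x| + s)) ^ 2 := mul_nonneg h4 (sq_nonneg _)
    have h6 : δ⁻¹ * (τ * |u x| - δ * (|w x| + s)) ^ 2 = δ⁻¹ * (τ ^ 2 * u x ^ 2) -
        2 * (τ * |u x|) * (|w x| + s) + δ * (|w x| + s) ^ 2 := by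
      rw [← sq_abs (u x)]
      linear_combination (-2 * (τ * |u x|) * (|w x| + s) + δ * (|w x| + s) ^ 2) * h3
    linarith
  refine hR.trans ?_
  have h7 := mul_le_mul_of_nonneg_left hsw hδ.le
  calc Λ * (2 * (τ * |u x|) * (|w x| + s) + τ ^ 2 * u x ^ 2)
      ≤ Λ * (δ⁻¹ * (τ ^ 2 * u x ^ 2) + δ * ((n + 1) * energy w k x) + τ ^ 2 * u x ^ 2) :=
        mul_le_mul_of_nonneg_left (by linarith) hΛ
    _ = _ := by ring

lemma Coeffs.Admissible.integrableOn_density {P : Coeffs n} {U : Set (E n)} {Λ : ℝ}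
    (hP : P.Admissible U Λ) (hΛ : 0 ≤ Λ) {u v : E n → ℝ} {g k : Fin n → E n → ℝ}
    (h : HasH1Gradient U u g) (h' : HasH1Gradient U v k) :
    IntegrableOn (P.density u g v k) U := by
  refine ((h.integrable_energy.const_mul 1).add (h'.integrable_energy.const_mul 1⁻¹)).const_mul
    (Λ * (n + 1)) |>.mono' ?_ ?_
  · have hu := h.1.aestronglyMeasurable.aemeasurable
    have hv := h'.1.aestronglyMeasurable.aemeasurable
    have hg := fun i => (h.2 i).aestronglyMeasurable.aemeasurable
    have hk := fun i => (h'.2 i).aestronglyMeasurable.aemeasurable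
    refine AEMeasurable.aestronglyMeasurable ?_
    unfold Coeffs.density
    refine ((Finset.aemeasurable_fun_sum _ fun i _ => Finset.aemeasurable_fun_sum _ fun j _ =>
      ((hP.measurable_A i j).mul (hg j)).mul (hk i)).add
      ((Finset.aemeasurable_fun_sum _ fun i _ => (hP.measurable_b i).mul (hg i)).mul hv)).add
      ((hP.measurable_c.mul hu).mul hv)
  · filter_upwards [hP.ae_boundedAt] with x hx
    exact P.abs_density_le hx one_pos hΛ u g v k

lemma Coeffs.form_eq (P : Coeffs n) {U : Set (E n)} (hU : IsOpen U) {u v : E n → ℝ}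
    {g k : Fin n → E n → ℝ} (h : HasH1Gradient U u g) (h' : HasH1Gradient U v k) :
    P.form U u v = ∫ x in U, P.density u g v k x := by
  refine integral_congr_ae ?_
  have h1 : ∀ᵐ x ∂(volume.restrict U), ∀ i, weakPartial U i u x = g i x :=
    ae_all_iff.2 fun i => (h.3 i).weakDeriv_ae_eq hU
  have h2 : ∀ᵐ x ∂(volume.restrict U), ∀ i, weakPartial U i v x = k i x :=
    ae_all_iff.2 fun i => (h'.3 i).weakDeriv_ae_eq hU
  filter_upwards [h1, h2] with x hx hx'
  simp only [Coeffs.density, hx, hx']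

lemma Coeffs.density_sub (P : Coeffs n) (u : E n → ℝ) (g : Fin n → E n → ℝ) (v v' : E n → ℝ)
    (k k' : Fin n → E n → ℝ) (x : E n) :
    P.density u g (fun y => v y - v' y) (fun i y => k i y - k' i y) x =
      P.density u g v k x - P.density u g v' k' x := by
  simp only [Coeffs.density, mul_sub, Finset.sum_sub_distrib]
  ring

/-! ### The estimate on a ball -/

/-- Positive diameter is needed to cancel powers of `h`; in dimension zero it would fail. -/
lemma meshSize_pos [NeZero n] {T : Set (E n)} (hT : IsOpen T) (hne : T.Nonempty)
    (hb : Bornology.IsBounded T) : 0 < meshSize T := by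
  obtain ⟨x, hx⟩ := hne
  have : Nonempty (Fin n) := ⟨0⟩
  exact Metric.diam_pos (infinite_of_mem_nhds x (hT.mem_nhds hx)).nontrivial hb

/-- The contribution of a single element. -/
lemma Coeffs.integral_abs_density_element_le {P : Coeffs n} {T : Set (E n)} {Λ : ℝ} (hT : IsOpen T)
    (hP : P.Admissible T Λ) (hΛ : 0 ≤ Λ) {u w e : E n → ℝ} {g k q : Fin n → E n → ℝ}
    (hu : HasH1Gradient T u g) (hw : HasH1Gradient T w k) (he : HasH1Gradient T e q)
    {h d B C M : ℝ} (hh : 0 < h) (hd : 0 < d) (hB : 0 ≤ B) (hM : 0 < M)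
    (hinv : sobolevNorm T 1 2 u ≤ ENNReal.ofReal (C * h⁻¹) * sobolevNorm T 0 2 u)
    (hsup : sobolevNorm T 1 2 e ≤ ENNReal.ofReal B *
      (ENNReal.ofReal (h / d) * gradNorm T w + ENNReal.ofReal (h / d ^ 2) * l2Norm T u)) :
    ∫ x in T, |P.density u g e q x| ≤
      Λ * (n + 1) * (M * C ^ 2 + 2 * B ^ 2 / M) / d ^ 2 * (∫ x in T, u x ^ 2) +
        Λ * (n + 1) * (2 * B ^ 2 / M) * ∫ x in T, energy w k x := by
  have hU : 0 ≤ ∫ x in T, u x ^ 2 := integral_nonneg fun _ => sq_nonneg _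
  have hW : 0 ≤ ∫ x in T, energy w k x := integral_nonneg fun _ => energy_nonneg _ _ _
  have hEu : 0 ≤ ∫ x in T, energy u g x := integral_nonneg fun _ => energy_nonneg _ _ _
  have hEe : 0 ≤ ∫ x in T, energy e q x := integral_nonneg fun _ => energy_nonneg _ _ _
  have hG : ∫ x in T, ∑ i, k i x ^ 2 ≤ ∫ x in T, energy w k x :=
    integral_mono (integrable_finsetSum _ fun i _ => (hw.2 i).integrable_sq) hw.integrable_energy
      fun x => le_add_of_nonneg_left (sq_nonneg _)
  have hG0 : 0 ≤ ∫ x in T, ∑ i, k i x ^ 2 :=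
    integral_nonneg fun _ => Finset.sum_nonneg fun _ _ => sq_nonneg _
  -- The inverse inequality, squared. Passing from `C` to `|C|` avoids a sign assumption on the
  -- constant.
  have h1 : ∫ x in T, energy u g x ≤ C ^ 2 / h ^ 2 * ∫ x in T, u x ^ 2 := by
    have hinv' := hinv.trans (mul_le_mul_left (ENNReal.ofReal_le_ofReal
      (mul_le_mul_of_nonneg_right (le_abs_self C) (inv_nonneg.2 hh.le))) _)
    rw [hu.sobolevNorm_eq hT, sobolevNorm_zero_two_eq hT hu.1,
      ← ENNReal.ofReal_mul (by positivity), ENNReal.ofReal_le_ofReal_iff (by positivity)] at hinv'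
    have := pow_le_pow_left₀ (Real.sqrt_nonneg _) hinv' 2
    rw [mul_pow, Real.sq_sqrt hEu, Real.sq_sqrt hU, mul_pow, sq_abs, inv_pow] at this
    rwa [div_eq_mul_inv]
  have h2 : ∫ x in T, energy e q x ≤
      2 * B ^ 2 * (h ^ 2 / d ^ 2) * ((∫ x in T, energy w k x) + (∫ x in T, u x ^ 2) / d ^ 2) := by
    rw [he.sobolevNorm_eq hT, hw.gradNorm_eq hT, l2Norm, eLpNorm_two_eq_sqrt hu.1,
      ← ENNReal.ofReal_mul (by positivity), ← ENNReal.ofReal_mul (by positivity),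
      ← ENNReal.ofReal_add (by positivity) (by positivity), ← ENNReal.ofReal_mul hB,
      ENNReal.ofReal_le_ofReal_iff (by positivity)] at hsup
    have := pow_le_pow_left₀ (Real.sqrt_nonneg _) hsup 2
    rw [Real.sq_sqrt hEe] at this
    have h3 := Real.sq_sqrt hG0
    have h4 := Real.sq_sqrt hU
    set a := √(∫ x in T, ∑ i, k i x ^ 2)
    set b := √(∫ x in T, u x ^ 2)
    have h5 : (B * (h / d * a + h / d ^ 2 * b)) ^ 2 =
        B ^ 2 * (h ^ 2 / d ^ 2) * (a + b / d) ^ 2 := by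
      field_simp
    have h6 : (a + b / d) ^ 2 ≤ 2 * (a ^ 2 + (b / d) ^ 2) := by
      nlinarith [sq_nonneg (a - b / d)]
    rw [div_pow, h3, h4] at h6
    rw [h5] at this
    calc _ ≤ _ := this
      _ ≤ B ^ 2 * (h ^ 2 / d ^ 2) * (2 * ((∫ x in T, energy w k x) + (∫ x in T, u x ^ 2) / d ^ 2)) :=
          mul_le_mul_of_nonneg_left (by linarith) (by positivity)
      _ = _ := by ring
  -- This Young weight balances the loss `h⁻²` from the inverse inequality against the gain `h²/d²`
  -- from superapproximation, so that the result is free of `h`.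
  have ht : 0 < M * (h ^ 2 / d ^ 2) := by positivity
  have h3 : ∫ x in T, |P.density u g e q x| ≤ Λ * (n + 1) *
      (M * (h ^ 2 / d ^ 2) * (∫ x in T, energy u g x) +
        (M * (h ^ 2 / d ^ 2))⁻¹ * ∫ x in T, energy e q x) := by
    rw [← integral_const_mul (M * (h ^ 2 / d ^ 2)), ← integral_const_mul (M * (h ^ 2 / d ^ 2))⁻¹,
      ← integral_add (hu.integrable_energy.const_mul _) (he.integrable_energy.const_mul _),
      ← integral_const_mul]
    refine integral_mono_ae (hP.integrableOn_density hΛ hu he).abs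
      (((hu.integrable_energy.const_mul _).add (he.integrable_energy.const_mul _)).const_mul _) ?_
    filter_upwards [hP.ae_boundedAt] with x hx
    exact P.abs_density_le hx ht hΛ u g e q
  refine h3.trans ?_
  have h4 := mul_le_mul_of_nonneg_left h1 ht.le
  have h5 := mul_le_mul_of_nonneg_left h2 (inv_pos.2 ht).le
  have hΛn : 0 ≤ Λ * (n + 1 : ℝ) := by positivity
  calc _ ≤ Λ * (n + 1) * (M * (h ^ 2 / d ^ 2) * (C ^ 2 / h ^ 2 * ∫ x in T, u x ^ 2) +
        (M * (h ^ 2 / d ^ 2))⁻¹ * (2 * B ^ 2 * (h ^ 2 / d ^ 2) *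
          ((∫ x in T, energy w k x) + (∫ x in T, u x ^ 2) / d ^ 2))) :=
        mul_le_mul_of_nonneg_left (add_le_add h4 h5) hΛn
    _ = _ := by
        field_simp
        ring

/-- Summation of the element contributions and of the commutator. -/
lemma Coeffs.energy_cutoff_le {P : Coeffs n} {U D : Set (E n)} {Λ : ℝ} (hU : IsOpen U)
    (hD : IsOpen D) (hDU : D ⊆ U) (hP : P.Admissible U Λ) (hΛ : 0 ≤ Λ)
    {u w ζ v : E n → ℝ} {g k t q : Fin n → E n → ℝ}
    (hu : HasH1Gradient U u g) (hw : HasH1Gradient U w k) (hv : HasH1Gradient U v q)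
    (hV : HasH1Gradient U (fun x => ζ x * w x) (fun i x => ζ x * k i x + t i x * w x))
    (hwx : ∀ x, w x = ζ x * u x) (hkx : ∀ i x, k i x = ζ x * g i x + t i x * u x)
    {m κ δ a b : ℝ} (hδ : 0 < δ) (ha : 0 ≤ a) (hb : 0 ≤ b) (ht : ∀ x ∈ U, ∀ i, |t i x| ≤ κ)
    (ht0 : ∀ x ∈ U, x ∉ D → ∀ i, t i x = 0)
    (hcoer : m * (∫ x in U, energy w k x) ≤ ∫ x in U, P.density w k w k x)
    (horth : ∫ x in U, P.density u g v q x = 0)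
    (𝒯 : Finset (Set (E n))) (hTo : ∀ T ∈ 𝒯, IsOpen T) (hTD : ∀ T ∈ 𝒯, T ⊆ D)
    (hdis : (𝒯 : Set (Set (E n))).PairwiseDisjoint id)
    (hoff : ∀ᵐ x ∂(volume.restrict U), x ∉ ⋃ T ∈ 𝒯, T → P.density u g (fun x => ζ x * w x - v x)
      (fun i x => (ζ x * k i x + t i x * w x) - q i x) x = 0)
    (hT : ∀ T ∈ 𝒯, ∫ x in T, |P.density u g (fun x => ζ x * w x - v x)
      (fun i x => (ζ x * k i x + t i x * w x) - q i x) x| ≤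
        a * (∫ x in T, u x ^ 2) + b * ∫ x in T, energy w k x) :
    m * (∫ x in U, energy w k x) ≤ (Λ * (n + 1) * δ + b) * (∫ x in U, energy w k x) +
      (Λ * (δ⁻¹ + 1) * (n * κ) ^ 2 + a) * ∫ x in D, u x ^ 2 := by
  set F := P.density u g (fun x => ζ x * w x - v x)
      (fun i x => (ζ x * k i x + t i x * w x) - q i x)
  have hFi : IntegrableOn F U := hP.integrableOn_density hΛ hu (hV.sub hv)
  have hVi := hP.integrableOn_density hΛ hu hV
  have hvi := hP.integrableOn_density hΛ hu hv
  have hwi := hP.integrableOn_density hΛ hw hw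
  -- Galerkin orthogonality: the test function `ζ²u` may be replaced by its interpolation error.
  have hFV : ∫ x in U, P.density u g (fun x => ζ x * w x)
      (fun i x => ζ x * k i x + t i x * w x) x = ∫ x in U, F x := by
    have : ∫ x in U, F x = (∫ x in U, P.density u g (fun x => ζ x * w x)
      (fun i x => ζ x * k i x + t i x * w x) x) - ∫ x in U, P.density u g v q x := by
      rw [← integral_sub hVi hvi]
      exact integral_congr_ae (ae_of_all _ fun x => P.density_sub u g _ v _ q x)
    rw [this, horth, sub_zero]
  set W := ⋃ T ∈ 𝒯, T
  have hWo : IsOpen W := isOpen_biUnion hTo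
  have hWD : W ⊆ D := iUnion₂_subset hTD
  have hui : IntegrableOn (fun x => u x ^ 2) U := hu.1.integrable_sq
  have hei := hw.integrable_energy
  have hsum : ∀ f : E n → ℝ, IntegrableOn f U → ∫ x in W, f x = ∑ T ∈ 𝒯, ∫ x in T, f x :=
    fun f hf => integral_biUnion_finset 𝒯 (fun T hT => (hTo T hT).measurableSet) hdis
      fun T hT => hf.mono_set ((hTD T hT).trans hDU)
  have hF : ∫ x in U, F x ≤ a * (∫ x in D, u x ^ 2) + b * ∫ x in U, energy w k x := by
    have h1 : ∫ x in U, |F x| = ∫ x in W, |F x| := by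
      refine setIntegral_eq_of_subset_of_ae_sdiff_eq_zero hU.measurableSet.nullMeasurableSet
        (hWD.trans hDU) ?_
      filter_upwards [(ae_restrict_iff' hU.measurableSet).1 hoff] with x hx hxd
      rw [hx hxd.1 hxd.2, abs_zero]
    have h2 : ∫ x in W, u x ^ 2 ≤ ∫ x in D, u x ^ 2 :=
      setIntegral_mono_set (hui.mono_set hDU) (ae_of_all _ fun _ => sq_nonneg _)
        hWD.eventuallyLE
    have h3 : ∫ x in W, energy w k x ≤ ∫ x in U, energy w k x :=
      setIntegral_mono_set hei (ae_of_all _ fun _ => energy_nonneg _ _ _)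
        (hWD.trans hDU).eventuallyLE
    calc ∫ x in U, F x ≤ ∫ x in U, |F x| := integral_mono hFi hFi.abs fun x => le_abs_self _
      _ = ∑ T ∈ 𝒯, ∫ x in T, |F x| := by rw [h1, hsum _ hFi.abs]
      _ ≤ ∑ T ∈ 𝒯, (a * (∫ x in T, u x ^ 2) + b * ∫ x in T, energy w k x) :=
          Finset.sum_le_sum hT
      _ = a * (∫ x in W, u x ^ 2) + b * ∫ x in W, energy w k x := by
          rw [hsum _ hui, hsum _ hei, Finset.sum_add_distrib, Finset.mul_sum, Finset.mul_sum]
      _ ≤ _ := add_le_add (mul_le_mul_of_nonneg_left h2 ha) (mul_le_mul_of_nonneg_left h3 hb)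
  -- The derivatives of `ζ` vanish off `D`, so the commutator involves `u` on `D` only.
  have hDi : IntegrableOn (D.indicator fun x => u x ^ 2) U := hui.indicator hD.measurableSet
  have hR : (∫ x in U, P.density w k w k x) - ∫ x in U, P.density u g (fun x => ζ x * w x)
      (fun i x => ζ x * k i x + t i x * w x) x ≤ Λ * (n + 1) * δ * (∫ x in U, energy w k x) +
        Λ * (δ⁻¹ + 1) * (n * κ) ^ 2 * ∫ x in D, u x ^ 2 := by
    have h1 : ∫ x in D, u x ^ 2 = ∫ x in U, D.indicator (fun x => u x ^ 2) x := by
      rw [setIntegral_indicator hD.measurableSet, inter_eq_right.2 hDU]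
    rw [← integral_sub hwi hVi, h1, ← integral_const_mul, ← integral_const_mul,
      ← integral_add (hei.const_mul _) (hDi.const_mul _)]
    refine integral_mono_ae (hwi.sub hVi) ((hei.const_mul _).add (hDi.const_mul _)) ?_
    filter_upwards [hP.ae_boundedAt, ae_restrict_mem hU.measurableSet] with x hx hxU
    refine (le_abs_self _).trans ((P.abs_density_sub_le hx hδ hΛ u ζ g t (hwx x)
      fun i => hkx i x).trans ?_)
    have h2 : (∑ i, |t i x|) ^ 2 * u x ^ 2 ≤
        (n * κ) ^ 2 * D.indicator (fun x => u x ^ 2) x := by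
      by_cases hxD : x ∈ D
      · rw [indicator_of_mem hxD]
        refine mul_le_mul_of_nonneg_right (pow_le_pow_left₀
          (Finset.sum_nonneg fun _ _ => abs_nonneg _) ?_ 2) (sq_nonneg _)
        simpa using Finset.sum_le_sum fun i (_ : i ∈ Finset.univ) => ht x hxU i
      · rw [indicator_of_notMem hxD]
        simp [ht0 x hxU hxD]
    have h3 : 0 ≤ Λ * (δ⁻¹ + 1) := mul_nonneg hΛ (by positivity)
    have h4 := mul_le_mul_of_nonneg_left h2 h3
    linarith
  rw [hFV] at hR
  linarith

lemma neZero_of_frontier_nonempty {G : Set (E n)} (h : (frontier G).Nonempty) : NeZero n := by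
  refine ⟨fun h0 => ?_⟩
  subst h0
  obtain ⟨x, hx⟩ := h
  rcases G.eq_empty_or_nonempty with h | h
  · simp [h] at hx
  · simp [Subsingleton.eq_univ_of_nonempty h] at hx

/-- The pair of concentric sets around `z` to which the local approximation property is applied. -/
lemma LocalApproximation.exists_interpolant {Ω Ω₀ ΓD : Set (E n)} {𝒯 : Set (Set (E n))}
    {S : Submodule ℝ (E n → ℝ)} {G : Set (E n)} {d : ℝ} {r : ℕ} {C : ℝ → ℝ}
    (h : LocalApproximation Ω Ω₀ ΓD 𝒯 S G (d / 4) d r C) (hΩ : IsOpen Ω) (hΩc : IsPreconnected Ω)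
    (hG : G ⊆ Ω) (hd : 0 < d) {z : E n} (hzG : z ∈ G) (hF : (frontier G \ frontier Ω).Nonempty)
    (hfr : Metric.ball z d ∩ frontier G ⊆ frontier Ω) :
    ∃ (G₁ : Set (E n)) (I : (E n → ℝ) → (E n → ℝ)), Metric.ball z (d / 4) ∩ G ⊆ G₁ ∧
      IsLocalInterpolant Ω Ω₀ ΓD S G₁ (Metric.ball z (d / 2) ∩ G) I ∧
      Superapproximation Ω Ω₀ ΓD 𝒯 S G₁ I d r C := by
  have hVo := isOpen_ball_inter hΩ hG hfr (by linarith : d / 2 ≤ d)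
  set V := Metric.ball z (d / 2) ∩ G
  -- The relative boundary of `V` is at distance at least `d/2` from `z`, hence more than `d/4` from
  -- the open ball of radius `d/4`.
  have hsub : Metric.ball z (d / 4) ∩ G ⊆
      V ∩ {x | ENNReal.ofReal (d / 4) < Metric.infEDist x (frontier V \ frontier Ω)} := by
    rintro x ⟨hxb, hxG⟩
    have hx := Metric.mem_ball.1 hxb
    refine ⟨⟨Metric.mem_ball.2 (by linarith), hxG⟩, ?_⟩
    refine lt_of_lt_of_le (b := ENNReal.ofReal (d / 2 - dist x z)) ?_
      (Metric.le_infEDist.2 fun y hy => ?_)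
    · exact (ENNReal.ofReal_lt_ofReal_iff (by linarith)).2 (by linarith)
    · rw [edist_dist]
      refine ENNReal.ofReal_le_ofReal ?_
      have h1 := le_dist_of_mem_frontier hΩ hG hfr (by linarith : d / 2 ≤ d) hy
      have h2 := dist_triangle y x z
      rw [dist_comm y x] at h2
      linarith
  have hz : z ∈ Metric.ball z (d / 4) ∩ G := ⟨Metric.mem_ball_self (by linarith), hzG⟩
  have hne : V ≠ Ω := fun hV => by
    have : G = Ω := hG.antisymm (hV ▸ inter_subset_right)
    rw [this, sdiff_self] at hF
    exact not_nonempty_empty hF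
  have hdist := setDist_eq_of_isPreconnected hΩ hΩc hVo (inter_subset_right.trans hG) hne
    ⟨z, hsub hz⟩
  obtain ⟨I, hI, hI'⟩ := h _ V
    (hVo.inter (isOpen_lt continuous_const Metric.continuous_infEDist)) hVo inter_subset_left
    inter_subset_right hdist
  exact ⟨_, I, hsub, hI, hI'⟩

/-- The local energy estimate on concentric balls. -/
theorem exists_energy_ball_le (n r : ℕ) (Λ C₁ C₂ : ℝ) (C₃ : ℝ → ℝ) :
    ∃ C : ℝ, 0 < C ∧
      ∀ (Ω Ω₀ ΓD : Set (E n)), IsOpen Ω → IsPreconnected Ω → IsOpen Ω₀ →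
        Bornology.IsBounded Ω₀ → Ω₀ ⊆ Ω →
      ∀ P : Coeffs n, P.Admissible Ω₀ Λ →
      ∀ d₀ : ℝ, LocallyCoercive P Ω Ω₀ d₀ C₁ →
      ∀ 𝒯 : Set (Set (E n)), IsTriangulation Ω Ω₀ 𝒯 →
      ∀ S : Submodule ℝ (E n → ℝ), (∀ χ ∈ S, ∀ T ∈ 𝒯, sobolevNorm T 1 2 χ ≤
        ENNReal.ofReal (C₂ * (meshSize T)⁻¹) * sobolevNorm T 0 2 χ) →
      ∀ (G : Set (E n)) (d : ℝ), G ⊆ Ω₀ → 0 < d → d ≤ 2 * d₀ →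
        (frontier G \ frontier Ω).Nonempty →
        LocalApproximation Ω Ω₀ ΓD 𝒯 S G (d / 4) d r C₃ →
        (∀ T ∈ 𝒯, (T ∩ G).Nonempty → meshSize T / d ≤ 1 / 4) →
      ∀ u ∈ S, u ∈ H1D0 Ω₀ ΓD →
        (∀ v ∈ S, v ∈ H1D0 Ω₀ ΓD → v ∈ H1Lt Ω Ω₀ → P.form Ω₀ u v = 0) →
      ∀ z ∈ G, Metric.ball z d ∩ frontier G ⊆ frontier Ω →
        ∫ x in Metric.ball z (d / 8) ∩ G, energy u (fun i => weakPartial Ω₀ i u) x ≤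
          C / d ^ 2 * ∫ x in Metric.ball z d ∩ G, u x ^ 2 := by
  obtain ⟨K, hK, hcut⟩ := exists_cutoff_inter n r
  -- Absolute values plus one make all constants positive without sign hypotheses. The choices of
  -- `δ` and `M` make the two coefficients of the energy of `w` equal to `m/4` each, so half of the
  -- coercivity constant survives absorption.
  set L : ℝ := |Λ| + 1 with hL
  have hL0 : 0 < L := by positivity
  set N : ℝ := n + 1 with hN
  have hN0 : 0 < N := by positivity
  set m : ℝ := (|C₁| + 1)⁻¹ with hm
  have hm0 : 0 < m := by positivity
  set B : ℝ := |C₃ K| + 1 with hB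
  have hB0 : 0 < B := by positivity
  set δ : ℝ := m / (4 * (L * N)) with hδ
  have hδ0 : 0 < δ := by positivity
  set M : ℝ := 8 * (L * N) * B ^ 2 / m with hM
  have hM0 : 0 < M := by positivity
  set D₀ : ℝ := L * (δ⁻¹ + 1) * (n * K) ^ 2 + L * N * (M * C₂ ^ 2 + 2 * B ^ 2 / M) with hD₀
  have hD₀0 : 0 < D₀ := by positivity
  refine ⟨2 / m * D₀, by positivity, ?_⟩
  intro Ω Ω₀ ΓD hΩ hΩc hΩ₀ hΩ₀b hΩ₀Ω P hP d₀ hcoer 𝒯 h𝒯 S hinv G d hGΩ₀ hd hdd₀ hF happ hmesh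
    u huS hu horth z hzG hfr
  have hGΩ : G ⊆ Ω := hGΩ₀.trans hΩ₀Ω
  have hn : NeZero n := neZero_of_frontier_nonempty (hF.mono sdiff_subset)
  have hP' : P.Admissible Ω₀ L := hP.mono ((le_abs_self Λ).trans (by linarith))
  obtain ⟨G₁, I, hG₁, hI, hsup⟩ := happ.exists_interpolant hΩ hΩc hGΩ hd hzG hF hfr
  obtain ⟨ζ, hζs, hζ0, hζ1, hζone, hζone', hζsupp, hζoff, hζj, hζd⟩ := hcut z d hd Ω G hΩ hGΩ hfr
  set D := Metric.ball z d ∩ G with hD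
  have hDo : IsOpen D := isOpen_ball_inter hΩ hGΩ hfr le_rfl
  have hDΩ₀ : D ⊆ Ω₀ := inter_subset_right.trans hGΩ₀
  have hb4 : Metric.ball z (d / 4) ∩ G ⊆ D :=
    inter_subset_inter_left _ (Metric.ball_subset_ball (by linarith))
  have hζb : ∀ x ∈ Ω, |ζ x| ≤ 1 + K / d := fun x _ => by
    rw [abs_of_nonneg (hζ0 x)]
    have : 0 ≤ K / d := by positivity
    linarith [hζ1 x]
  have hζb' : ∀ x ∈ Ω, ∀ i, |partialDeriv i ζ x| ≤ 1 + K / d := fun x hx i =>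
    (hζd x hx i).trans (by linarith)
  have hζt : ∀ x ∈ Ω, x ∉ Metric.ball z (d / 4) ∩ G → ∀ i, partialDeriv i ζ x = 0 :=
    fun x hx hx' i => partialDeriv_eq_zero_of_notMem_tsupport (fun h => hx' (hζsupp ⟨h, hx⟩)) i
  have hsuppΩ₀ : tsupport ζ ∩ Ω ⊆ Ω₀ := hζsupp.trans (hb4.trans hDΩ₀)
  -- the functions `u`, `w = ζ u` and `ζ² u`
  have hug := hasH1Gradient_of_mem_H1 hΩ₀ hu.1
  set g := fun i => weakPartial Ω₀ i u with hg
  set t : Fin n → E n → ℝ := fun i => partialDeriv i ζ with htdef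
  set w : E n → ℝ := fun x => ζ x * u x with hw
  set k : Fin n → E n → ℝ := fun i x => ζ x * g i x + t i x * u x with hk
  have hwΩ : HasH1Gradient Ω w k := hug.mul_smooth hΩ₀ hΩ hΩ₀Ω hζs hζb hζb' hsuppΩ₀
  have hVΩ : HasH1Gradient Ω (fun x => ζ x * w x) (fun i x => ζ x * k i x + t i x * w x) :=
    hwΩ.mul_smooth hΩ hΩ subset_rfl hζs hζb hζb' inter_subset_right
  have hζΩ : HasH1Gradient Ω (fun x => ζ x * 1) (fun i x => ζ x * 0 + t i x * 1) :=
    (hasH1Gradient_one hΩ₀b).mul_smooth hΩ₀ hΩ hΩ₀Ω hζs hζb hζb' hsuppΩ₀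
  have hVeq : (fun x => ζ x ^ 2 * u x) = fun x => ζ x * w x := by
    funext x; simp only [hw]; ring
  have hw₀ := hwΩ.mono hΩ₀Ω
  have hV₀ := hVΩ.mono hΩ₀Ω
  -- the test function
  have hζG₁ : ∀ x, x ∉ G₁ → ζ x = 0 := fun x hx => hζoff x fun h => hx (hG₁ h)
  have hVLt : (fun x => ζ x ^ 2 * u x) ∈ H1Lt Ω G₁ := by
    refine ⟨hVeq ▸ hVΩ.mem_H1 hΩ, ae_of_all _ fun x hx => ?_⟩
    simp [hζG₁ x hx.2]
  have hVD0 : (fun x => ζ x ^ 2 * u x) ∈ H1D0 Ω₀ ΓD := by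
    refine ⟨hVeq ▸ hV₀.mem_H1 hΩ₀, hu.2.of_abs_le hug.1 fun x => ?_⟩
    rw [abs_mul, abs_of_nonneg (sq_nonneg _)]
    exact mul_le_of_le_one_left (abs_nonneg _) (pow_le_one₀ (hζ0 x) (hζ1 x))
  set v := I fun x => ζ x ^ 2 * u x with hv
  have hv1 := hI.1 _ hVLt
  have hv2 := hI.2 _ hVD0
  have hvLt : v ∈ H1Lt Ω Ω₀ := by
    refine ⟨hv1.2.1, ?_⟩
    filter_upwards [hv1.2.2] with x hx hx'
    exact hx ⟨hx'.1, fun h => hx'.2 (hGΩ₀ h.2)⟩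
  have hform := horth v hv1.1 hv2.2 hvLt
  have hvq := hasH1Gradient_of_mem_H1 hΩ₀ hv2.2.1
  set q := fun i => weakPartial Ω₀ i v
  rw [P.form_eq hΩ₀ hug hvq] at hform
  have he := hV₀.sub hvq
  -- coercivity
  have hwoff : ∀ x ∈ Ω₀, x ∉ Metric.ball z (d / 4) ∩ Ω₀ → energy w k x = 0 := fun x hx hx' => by
    have hx2 : x ∉ Metric.ball z (d / 4) ∩ G := fun h => hx' ⟨h.1, hx⟩
    simp [energy, hw, hk, htdef, hζoff x hx2, hζt x (hΩ₀Ω hx) hx2]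
  have hcoer' : m * (∫ x in Ω₀, energy w k x) ≤ ∫ x in Ω₀, P.density w k w k x := by
    have hwLt : w ∈ H1Lt Ω (Metric.ball z (d / 4) ∩ Ω₀) := by
      refine ⟨hwΩ.mem_H1 hΩ, ae_of_all _ fun x hx => ?_⟩
      have hx2 : x ∉ Metric.ball z (d / 4) ∩ G := fun h => hx.2 ⟨h.1, hGΩ₀ h.2⟩
      simp [hw, hζoff x hx2]
    -- The ball has diameter `d/2`, which is at most `d₀` because `d ≤ 2 d₀`.
    have h1 := (hcoer.coercive z (d / 4) (by linarith) (by linarith) w hwLt).1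
    have hBo : IsOpen (Metric.ball z (d / 4) ∩ Ω₀) := Metric.isOpen_ball.inter hΩ₀
    rw [(hw₀.mono inter_subset_right).sobolevNorm_eq hBo,
      ENNReal.toReal_ofReal (Real.sqrt_nonneg _),
      Real.sq_sqrt (integral_nonneg fun _ => energy_nonneg _ _ _), P.form_eq hΩ₀ hw₀ hw₀,
      ← setIntegral_eq_of_subset_of_forall_sdiff_eq_zero hΩ₀.measurableSet inter_subset_right
        fun x hx => hwoff x hx.1 hx.2] at h1
    refine le_trans (mul_le_mul_of_nonneg_right ?_
      (integral_nonneg fun _ => energy_nonneg _ _ _)) h1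
    exact inv_anti₀ hcoer.C₁_pos ((le_abs_self C₁).trans (by linarith))
  -- the elements that meet the support of the test function
  set 𝒮 : Set (Set (E n)) := {T ∈ 𝒯 | (T ∩ (Metric.ball z (d / 2) ∩ G)).Nonempty}
  have h𝒮f : 𝒮.Finite := h𝒯.finite.subset (sep_subset _ _)
  have h𝒮d : ∀ T ∈ 𝒮, meshSize T ≤ d / 4 := fun T hT => by
    have := hmesh T hT.1 (hT.2.mono (inter_subset_inter_right _ inter_subset_right))
    rw [div_le_iff₀ hd] at this
    linarith
  have h𝒮D : ∀ T ∈ 𝒮, T ⊆ D := fun T hT =>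
    subset_ball_inter_of_diam_le hΩ hGΩ hfr (h𝒯.isConnected T hT.1).isPreconnected
      (h𝒯.isBounded T hT.1) (h𝒯.subset T hT.1) hT.2 (h𝒮d T hT) hd
  set e : E n → ℝ := fun x => ζ x * w x - v x with hedef
  set p : Fin n → E n → ℝ := fun i x => (ζ x * k i x + t i x * w x) - q i x with hpdef
  -- Such an element misses the supports of both `ζ²u` and its interpolant. The intersection with
  -- `Ω₀` matters, since an element may protrude from `Ω₀`, where `u` and its gradient carry no
  -- information.
  have heT : ∀ T ∈ 𝒯, T ∉ 𝒮 → ∀ᵐ x, x ∈ T ∩ Ω₀ → e x = 0 ∧ ∀ i, p i x = 0 := by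
    intro T hT hTS
    have hTo : IsOpen (T ∩ Ω₀) := (h𝒯.isOpen T hT).inter hΩ₀
    have hTn : ∀ x ∈ T, x ∉ Metric.ball z (d / 2) ∩ G := fun x hx hx' => hTS ⟨hT, x, hx, hx'⟩
    have he0 : e =ᵐ[volume.restrict (T ∩ Ω₀)] 0 := by
      filter_upwards [ae_restrict_of_ae hv1.2.2, ae_restrict_mem hTo.measurableSet] with x hx hxT
      have hx2 : x ∉ Metric.ball z (d / 4) ∩ G := fun h =>
        hTn x hxT.1 ⟨Metric.ball_subset_ball (by linarith) h.1, h.2⟩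
      have hvx := hx ⟨hΩ₀Ω hxT.2, hTn x hxT.1⟩
      simp only [hedef, hζoff x hx2, zero_mul, Pi.zero_apply, zero_sub, neg_eq_zero]
      exact hvx
    have hp0 := fun i => (he.mono inter_subset_right).ae_eq_zero hTo he0 i
    rw [← ae_restrict_iff' hTo.measurableSet]
    filter_upwards [he0, ae_all_iff.2 hp0] with x hx hx'
    exact ⟨hx, hx'⟩
  have hoff : ∀ᵐ x ∂(volume.restrict Ω₀), x ∉ ⋃ T ∈ h𝒮f.toFinset, T →
      P.density u g e p x = 0 := by
    have h1 : ∀ᵐ x, ∀ T ∈ 𝒯, T ∉ 𝒮 → x ∈ T ∩ Ω₀ → e x = 0 ∧ ∀ i, p i x = 0 := by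
      refine (ae_ball_iff h𝒯.finite.countable).2 fun T hT => ?_
      by_cases hTS : T ∈ 𝒮
      · exact ae_of_all _ fun x h => absurd hTS h
      · filter_upwards [heT T hT hTS] with x hx _
        exact hx
    -- Closed elements cover `Ω₀` and their frontiers are null, so almost every point lies in an
    -- open element.
    have h2 : ∀ᵐ x : E n, ∀ T ∈ 𝒯, x ∉ frontier T :=
      (ae_ball_iff h𝒯.finite.countable).2 fun T hT =>
        measure_eq_zero_iff_ae_notMem.1 (h𝒯.null_frontier T hT)
    filter_upwards [ae_restrict_of_ae h1, ae_restrict_of_ae h2,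
      ae_restrict_mem hΩ₀.measurableSet] with x hx1 hx2 hxΩ hx
    obtain ⟨T, hT, hxT⟩ := mem_iUnion₂.1 (h𝒯.covers hxΩ)
    have hxT' : x ∈ T := by
      by_contra hn
      refine hx2 T hT ?_
      rw [(h𝒯.isOpen T hT).frontier_eq]
      exact ⟨hxT, hn⟩
    have hTS : T ∉ 𝒮 := fun h => hx (mem_iUnion₂.2 ⟨T, h𝒮f.mem_toFinset.2 h, hxT'⟩)
    obtain ⟨h3, h4⟩ := hx1 T hT hTS ⟨hxT', hxΩ⟩
    simp [Coeffs.density, h3, h4]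
  have helem : ∀ T ∈ h𝒮f.toFinset, ∫ x in T, |P.density u g e p x| ≤
      L * N * (M * C₂ ^ 2 + 2 * B ^ 2 / M) / d ^ 2 * (∫ x in T, u x ^ 2) +
        L * N * (2 * B ^ 2 / M) * ∫ x in T, energy w k x := by
    intro T hT
    have hT := h𝒮f.mem_toFinset.1 hT
    have hTo := h𝒯.isOpen T hT.1
    have hTΩ₀ := (h𝒮D T hT).trans hDΩ₀
    have hPT : P.Admissible T L := by
      have hr := Measure.restrict_mono hTΩ₀ (le_refl (volume : Measure (E n)))
      exact ⟨fun i j => (hP'.1 i j).mono_measure hr, fun i => (hP'.2 i).mono_measure hr,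
        hP'.3.mono_measure hr, ae_mono hr hP'.4, ae_mono hr hP'.5, ae_mono hr hP'.6,
        ae_mono hr hP'.7⟩
    refine Coeffs.integral_abs_density_element_le hTo hPT hL0.le (hug.mono hTΩ₀) (hw₀.mono hTΩ₀)
      (he.mono hTΩ₀) (meshSize_pos hTo (h𝒯.isConnected T hT.1).nonempty (h𝒯.isBounded T hT.1))
      hd hB0.le hM0 (hinv u huS T hT.1) ?_
    have h1 := hsup K hK ζ (hζs.mono hΩ₀Ω) ⟨?_, ae_of_all _ fun x hx => hζG₁ x hx.2⟩
      (fun j hj x hx => hζj j hj x (hΩ₀Ω hx)) u huS hu T hT.1 ((h𝒮d T hT).trans (by linarith))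
    · have h2 : (fun x => ζ x ^ 2 * u x - I (fun y => ζ y ^ 2 * u y) x) = e := by
        funext x
        simp only [hedef, hv, hw]
        ring
      rw [h2] at h1
      refine h1.trans (mul_le_mul_left (ENNReal.ofReal_le_ofReal ?_) _)
      exact (le_abs_self _).trans (by linarith)
    · have := hζΩ.mem_H1 hΩ
      simpa using this
  have key := Coeffs.energy_cutoff_le (m := m) (κ := K / d) (δ := δ) hΩ₀ hDo hDΩ₀ hP' hL0.le
    hug hw₀ hvq hV₀ (fun _ => rfl) (fun _ _ => rfl) hδ0 (by positivity)
    (by positivity) (fun x hx => hζd x (hΩ₀Ω hx))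
    (fun x hx hx' => hζt x (hΩ₀Ω hx) fun h => hx' (hb4 h)) hcoer' hform h𝒮f.toFinset
    (fun T hT => h𝒯.isOpen T (h𝒮f.mem_toFinset.1 hT).1)
    (fun T hT => h𝒮D T (h𝒮f.mem_toFinset.1 hT))
    (by rw [h𝒮f.coe_toFinset]; exact h𝒯.pairwiseDisjoint.subset (sep_subset _ _))
    hoff helem
  have hX : ∫ x in Metric.ball z (d / 8) ∩ G, energy u g x ≤ ∫ x in Ω₀, energy w k x := by
    have hb8 := isOpen_ball_inter hΩ hGΩ hfr (by linarith : d / 8 ≤ d)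
    have h1 : ∫ x in Metric.ball z (d / 8) ∩ G, energy u g x =
        ∫ x in Metric.ball z (d / 8) ∩ G, energy w k x := by
      refine setIntegral_congr_fun hb8.measurableSet fun x hx => ?_
      simp [energy, hw, hk, htdef, hζone x hx, hζone' x hx]
    rw [h1]
    exact setIntegral_mono_set hw₀.integrable_energy (ae_of_all _ fun _ => energy_nonneg _ _ _)
      (inter_subset_right.trans hGΩ₀).eventuallyLE
  refine hX.trans ?_
  set X := ∫ x in Ω₀, energy w k x
  set Y := ∫ x in D, u x ^ 2
  have hc1 : L * N * δ = m / 4 := by rw [hδ]; field_simp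
  have hc2 : L * N * (2 * B ^ 2 / M) = m / 4 := by rw [hM]; field_simp; norm_num
  have hc3 : L * (δ⁻¹ + 1) * (n * (K / d)) ^ 2 +
      L * N * (M * C₂ ^ 2 + 2 * B ^ 2 / M) / d ^ 2 = D₀ / d ^ 2 := by
    rw [hD₀]; field_simp
  rw [hc1, hc2, hc3] at key
  have h3 : m / 2 * X ≤ D₀ / d ^ 2 * Y := by linarith
  calc X = 2 / m * (m / 2 * X) := by field_simp
    _ ≤ 2 / m * (D₀ / d ^ 2 * Y) := mul_le_mul_of_nonneg_left h3 (by positivity)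
    _ = _ := by ring

/-! ### Covering by balls -/

/-- The index of the cube of side `s` that contains `x`. -/
noncomputable def cubeIndex (s : ℝ) (x : E n) : Fin n → ℤ := fun i => ⌊x i / s⌋

lemma dist_le_of_cubeIndex_eq {s : ℝ} (hs : 0 < s) {x y : E n}
    (h : cubeIndex s x = cubeIndex s y) : dist x y ≤ n * s := by
  have hi : ∀ i, |x i - y i| ≤ s := fun i => by
    have h1 := Int.abs_sub_lt_one_of_floor_eq_floor (congrFun h i)
    rw [← sub_div, abs_div, abs_of_pos hs, div_lt_one hs] at h1
    exact h1.le
  have h2 : ‖x - y‖ ≤ ∑ i, |x i - y i| := by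
    rw [EuclideanSpace.norm_eq]
    refine Real.sqrt_le_iff.2 ⟨Finset.sum_nonneg fun _ _ => abs_nonneg _, ?_⟩
    simpa using Finset.sum_sq_le_sq_sum_of_nonneg
      (s := Finset.univ) (f := fun i => |x i - y i|) fun _ _ => abs_nonneg _
  rw [dist_eq_norm]
  refine h2.trans ?_
  simpa using Finset.sum_le_sum fun i (_ : i ∈ Finset.univ) => hi i

/-- Each coordinate moves by less than `c` cube sides, so its index changes by at most `c`; this is
what bounds the overlap. -/
lemma cubeIndex_mem_Icc {s : ℝ} (hs : 0 < s) {x y : E n} {c : ℕ} (h : dist x y < c * s) :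
    cubeIndex s x ∈ Finset.Icc (fun i => cubeIndex s y i - c) (fun i => cubeIndex s y i + c) := by
  have hi : ∀ i, |x i / s - y i / s| < c := fun i => by
    rw [← sub_div, abs_div, abs_of_pos hs, div_lt_iff₀ hs]
    refine lt_of_le_of_lt ?_ h
    rw [dist_eq_norm]
    exact PiLp.norm_apply_le (x - y) i
  rw [Finset.mem_Icc]
  refine ⟨fun i => ?_, fun i => ?_⟩
  · have := (abs_lt.1 (hi i)).1
    refine Int.le_floor.2 ?_
    have h2 := Int.floor_le (y i / s)
    simp only [cubeIndex]
    push_cast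
    linarith
  · have := (abs_lt.1 (hi i)).2
    rw [← Int.lt_add_one_iff]
    refine Int.floor_lt.2 ?_
    have h2 := Int.lt_floor_add_one (y i / s)
    simp only [cubeIndex]
    push_cast
    linarith

/-- A set is covered by countably many balls centred in it such that the concentric balls of
eight times the radius overlap at most `N` times. -/
lemma exists_lintegral_covering (n : ℕ) : ∃ N : ℕ, 0 < N ∧ ∀ (G₀ : Set (E n)) (d : ℝ), 0 < d →
    ∃ Z : Set (E n), Z.Countable ∧ Z ⊆ G₀ ∧ G₀ ⊆ ⋃ z ∈ Z, Metric.ball z (d / 8) ∧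
      ∀ (f : E n → ℝ≥0∞) (D : Set (E n)), AEMeasurable f (volume.restrict D) →
        ∑' z : Z, ∫⁻ x in Metric.ball (z : E n) d, f x ∂(volume.restrict D) ≤
          N * ∫⁻ x in D, f x := by
  refine ⟨(2 * (8 * (n + 1)) + 1) ^ n, by positivity, fun G₀ d hd => ?_⟩
  -- A cube has diameter at most `n s < d/8`, so one chosen point of `G₀` per cube suffices. As `d =
  -- 8(n+1)s`, centres within `d` of `x` have indices in a box of side `2·8(n+1)+1`.
  set s : ℝ := d / (8 * (n + 1)) with hs
  have hs0 : 0 < s := by positivity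
  choose! c hcG hcI using fun (k : Fin n → ℤ) (hk : k ∈ cubeIndex s '' G₀) => hk
  refine ⟨c '' (cubeIndex s '' G₀), (to_countable _).image _, ?_, ?_, ?_⟩
  · rintro _ ⟨k, hk, rfl⟩
    exact hcG k hk
  · intro x hx
    have hk : cubeIndex s x ∈ cubeIndex s '' G₀ := mem_image_of_mem _ hx
    refine mem_iUnion₂.2 ⟨_, mem_image_of_mem _ hk, Metric.mem_ball.2 ?_⟩
    refine (dist_le_of_cubeIndex_eq hs0 (hcI _ hk).symm).trans_lt ?_
    rw [hs, mul_div_assoc', div_lt_div_iff₀ (by positivity) (by positivity)]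
    nlinarith
  · intro f D hf
    set Z := c '' (cubeIndex s '' G₀)
    have hZc : Z.Countable := (to_countable _).image _
    have : Countable Z := hZc.to_subtype
    have hinj : ∀ z ∈ Z, ∀ z' ∈ Z, cubeIndex s z = cubeIndex s z' → z = z' := by
      rintro _ ⟨k, hk, rfl⟩ _ ⟨k', hk', rfl⟩ h
      rw [hcI k hk, hcI k' hk'] at h
      rw [h]
    simp_rw [← lintegral_indicator Metric.isOpen_ball.measurableSet]
    rw [← lintegral_tsum fun z => hf.indicator Metric.isOpen_ball.measurableSet,
      ← lintegral_const_mul'' _ hf]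
    refine lintegral_mono fun x => ?_
    set J := Finset.Icc (fun i => cubeIndex s x i - ((8 * (n + 1) : ℕ) : ℤ))
      (fun i => cubeIndex s x i + ((8 * (n + 1) : ℕ) : ℤ))
    have hJ : J.card = (2 * (8 * (n + 1)) + 1) ^ n := by
      rw [Pi.card_Icc, Finset.prod_congr rfl (g := fun _ => 2 * (8 * (n + 1)) + 1)]
      · simp
      · intro i _
        rw [Int.card_Icc]
        omega
    have hmem : ∀ z : Z, x ∈ Metric.ball (z : E n) d → cubeIndex s (z : E n) ∈ J := fun z hz => by
      refine cubeIndex_mem_Icc hs0 ?_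
      rw [dist_comm]
      refine (Metric.mem_ball.1 hz).trans_le (le_of_eq ?_)
      rw [hs]
      push_cast
      field_simp
    have hfin : {z : Z | x ∈ Metric.ball (z : E n) d}.Finite := by
      refine Finite.of_finite_image (f := fun z : Z => cubeIndex s (z : E n))
        (J.finite_toSet.subset ?_) fun z _ z' _ h => Subtype.ext (hinj z z.2 z' z'.2 h)
      rintro _ ⟨z, hz, rfl⟩
      exact hmem z hz
    rw [tsum_eq_sum (s := hfin.toFinset) fun z hz =>
      indicator_of_notMem (s := Metric.ball (z : E n) d) (a := x)
        (fun h => hz (hfin.mem_toFinset.2 h)) f]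
    have hcard : hfin.toFinset.card ≤ (2 * (8 * (n + 1)) + 1) ^ n := by
      rw [← hJ]
      exact Finset.card_le_card_of_injOn (fun z : Z => cubeIndex s (z : E n))
        (fun z hz => hmem z (hfin.mem_toFinset.1 hz))
        fun z _ z' _ h => Subtype.ext (hinj z z.2 z' z'.2 h)
    calc ∑ z ∈ hfin.toFinset, (Metric.ball (z : E n) d).indicator f x
        ≤ ∑ z ∈ hfin.toFinset, f x :=
          Finset.sum_le_sum fun z _ => indicator_le_self _ _ _
      _ = hfin.toFinset.card * f x := by rw [Finset.sum_const, nsmul_eq_mul]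
      _ ≤ _ := by gcongr

end LocalFEM

/-! ### ### The discrete Caccioppoli estimate -/

open LocalFEM
theorem lemma3p1 (n r₂ r₃ : ℕ) (hr₂ : 1 ≤ r₂) (Λ C₁ C₂ : ℝ) (C₃ : ℝ → ℝ) :
    ∃ C : ℝ, 0 < C ∧
      ∀ (Ω Ω₀ ΓD : Set (E n)), IsOpen Ω → IsConnected Ω → IsOpen Ω₀ → IsConnected Ω₀ →
        Bornology.IsBounded Ω₀ → Ω₀ ⊆ Ω → ΓD ⊆ frontier Ω ∩ frontier Ω₀ →
      ∀ P : Coeffs n, P.Admissible Ω₀ Λ →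
      ∀ d₀ : ℝ, LocallyCoercive P Ω Ω₀ d₀ C₁ →
      ∀ 𝒯 : Set (Set (E n)), IsTriangulation Ω Ω₀ 𝒯 →
      ∀ S : Submodule ℝ (E n → ℝ), InverseProperties 𝒯 S r₂ C₂ →
      ∀ (G₀ G : Set (E n)) (d : ℝ), G₀ ⊆ G → G ⊆ Ω₀ → 0 < d → d ≤ 2 * d₀ →
        setDist G₀ (frontier G \ frontier Ω) = ENNReal.ofReal d →
        LocalApproximation Ω Ω₀ ΓD 𝒯 S G (d / 4) d r₃ C₃ →
        (∀ T ∈ 𝒯, (T ∩ G).Nonempty → meshSize T / d ≤ 1 / 4) →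
      ∀ u_h ∈ S, u_h ∈ H1D0 Ω₀ ΓD →
        (∀ v_h ∈ S, v_h ∈ H1D0 Ω₀ ΓD → v_h ∈ H1Lt Ω Ω₀ → P.form Ω₀ u_h v_h = 0) →
        h1NormOn Ω₀ G₀ u_h ≤ ENNReal.ofReal (C * (1 / d)) * l2Norm G u_h := by
  obtain ⟨C, hC, hloc⟩ := exists_energy_ball_le n r₃ Λ C₁ C₂ C₃
  obtain ⟨N, hN, hcov⟩ := exists_lintegral_covering n
  refine ⟨√(C * N), by positivity, ?_⟩
  intro Ω Ω₀ ΓD hΩ hΩc hΩ₀ _ hΩ₀b hΩ₀Ω _ P hP d₀ hcoer 𝒯 h𝒯 S hinv G₀ G d hG₀ hG hd hdd₀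
    hdist happ hmesh u huS hu horth
  -- An empty relative boundary would make the distance infinite.
  have hF : (frontier G \ frontier Ω).Nonempty := by
    by_contra hne
    rw [not_nonempty_iff_eq_empty.1 hne] at hdist
    simp [setDist] at hdist
  have hinv' : ∀ χ ∈ S, ∀ T ∈ 𝒯, sobolevNorm T 1 2 χ ≤
      ENNReal.ofReal (C₂ * (meshSize T)⁻¹) * sobolevNorm T 0 2 χ := fun χ hχ T hT => by
    -- Only the step from `L₂` to `H¹` is used; with `p = q` the dimensional exponents cancel.
    have := hinv χ hχ T hT 2 2 one_le_two le_rfl 0 1 zero_le_one hr₂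
    rwa [add_sub_cancel_right, Nat.cast_zero, Nat.cast_one, zero_sub, Real.rpow_neg_one] at this
  have hfr : ∀ z ∈ G₀, Metric.ball z d ∩ frontier G ⊆ frontier Ω := fun z hz =>
    ball_inter_frontier_subset (hdist ▸ (iInf₂_le z hz : setDist G₀ _ ≤ _))
  have hball := fun z (hz : z ∈ G₀) => hloc Ω Ω₀ ΓD hΩ hΩc.isPreconnected hΩ₀ hΩ₀b hΩ₀Ω P hP d₀
    hcoer 𝒯 h𝒯 S hinv' G d hG hd hdd₀ hF happ hmesh u huS hu horth z (hG₀ hz) (hfr z hz)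
  have hug := hasH1Gradient_of_mem_H1 hΩ₀ hu.1
  set g := fun i => weakPartial Ω₀ i u
  have hball' : ∀ z ∈ G₀, ∫⁻ x in Metric.ball z (d / 8) ∩ G, ENNReal.ofReal (energy u g x) ≤
      ENNReal.ofReal (C / d ^ 2) * ∫⁻ x in Metric.ball z d ∩ G, ENNReal.ofReal (u x ^ 2) := by
    intro z hz
    have hui : IntegrableOn (fun x => u x ^ 2) Ω₀ := hug.1.integrable_sq
    have hsub : ∀ r, Metric.ball z r ∩ G ⊆ Ω₀ := fun r => inter_subset_right.trans hG
    rw [← ofReal_integral_eq_lintegral_ofReal (hug.integrable_energy.mono_set (hsub _))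
      (ae_of_all _ fun _ => energy_nonneg _ _ _), ← ofReal_integral_eq_lintegral_ofReal
      (hui.mono_set (hsub _))
      (ae_of_all _ fun _ => sq_nonneg _), ← ENNReal.ofReal_mul (by positivity)]
    exact ENNReal.ofReal_le_ofReal (hball z hz)
  obtain ⟨Z, hZc, hZG₀, hcover, hover⟩ := hcov G₀ d hd
  have : Countable Z := hZc.to_subtype
  have hmeas : AEMeasurable (fun x => ENNReal.ofReal (u x ^ 2)) (volume.restrict G) :=
    (((hug.1.mono_measure (Measure.restrict_mono hG le_rfl)).aestronglyMeasurable.aemeasurable).pow_const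
      2).ennreal_ofReal
  have key : ∫⁻ x in G₀, ENNReal.ofReal (energy u g x) ≤
      ENNReal.ofReal (C * N / d ^ 2) * ∫⁻ x in G, ENNReal.ofReal (u x ^ 2) := by
    have hsub : G₀ ⊆ ⋃ z : Z, Metric.ball (z : E n) (d / 8) ∩ G := fun x hx => by
      obtain ⟨z, hz, hxz⟩ := mem_iUnion₂.1 (hcover hx)
      exact mem_iUnion.2 ⟨⟨z, hz⟩, hxz, hG₀ hx⟩
    -- Monotonicity and countable subadditivity of the lower integral suffice, so `G₀` and `G` need
    -- not be measurable.
    calc ∫⁻ x in G₀, ENNReal.ofReal (energy u g x)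
        ≤ ∫⁻ x in ⋃ z : Z, Metric.ball (z : E n) (d / 8) ∩ G, ENNReal.ofReal (energy u g x) :=
          lintegral_mono_set hsub
      _ ≤ ∑' z : Z, ∫⁻ x in Metric.ball (z : E n) (d / 8) ∩ G, ENNReal.ofReal (energy u g x) :=
          lintegral_iUnion_le _ _
      _ ≤ ∑' z : Z, ENNReal.ofReal (C / d ^ 2) *
            ∫⁻ x in Metric.ball (z : E n) d, ENNReal.ofReal (u x ^ 2) ∂(volume.restrict G) := by
          refine ENNReal.tsum_le_tsum fun z => ?_
          rw [Measure.restrict_restrict Metric.isOpen_ball.measurableSet]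
          exact hball' z (hZG₀ z.2)
      _ ≤ ENNReal.ofReal (C / d ^ 2) * (N * ∫⁻ x in G, ENNReal.ofReal (u x ^ 2)) := by
          rw [ENNReal.tsum_mul_left]
          gcongr
          exact hover _ _ hmeas
      _ = _ := by
          rw [← mul_assoc, ← ENNReal.ofReal_natCast N, ← ENNReal.ofReal_mul (by positivity)]
          congr 2
          ring
  have hl2 : l2Norm G u = (∫⁻ x in G, ENNReal.ofReal (u x ^ 2)) ^ (2⁻¹ : ℝ) := by
    rw [← eLpNorm_two_sq, ← ENNReal.rpow_mul, mul_inv_cancel₀ two_ne_zero, ENNReal.rpow_one,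
      l2Norm]
  have hconst : ENNReal.ofReal (√(C * N) * (1 / d)) =
      ENNReal.ofReal (C * N / d ^ 2) ^ (2⁻¹ : ℝ) := by
    rw [ENNReal.ofReal_rpow_of_nonneg (by positivity) (by norm_num), ← one_div (2 : ℝ),
      ← Real.sqrt_eq_rpow, Real.sqrt_div (by positivity), Real.sqrt_sq hd.le, mul_one_div]
  rw [hug.h1NormOn_eq hΩ₀ (hG₀.trans hG), hl2, hconst, ← ENNReal.mul_rpow_of_nonneg _ _ (by norm_num)]
  exact ENNReal.rpow_le_rpow key (by norm_num)
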